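/- Let $G=\langle a,b,c,d \mid a^4=b^2=d^2=1,\ c^2=a^2,\ bab=a^{-1},\ ac=ca,\ ad=da,\ bc=cb,\ bd=db,\ dcd=a^2c\rangle$ be the extraspecial group $2_+^{1+4}$ of order $32$, and let $\bar\rho\colon G\to \mathrm{GL}_2(\mathbf F_2)$ be the trivial representation. For a commutative ring $A$, a *determinant* of $G$ over $A$ of dimension $2$ is a multiplicative polynomial law $D\colon A[G]\to A$, homogeneous of degree $2$; for $g\in G$ write $D(X-g)=X^2-T(g)X+D(g)\in A[X]$ for its characteristic polynomial. A representation $\rho\colon G\to\mathrm{GL}_2(A)$ gives the determinant $D_\rho=\det\circ\rho$. Let $\mathcal C$ be the category of Artinian local $\mathbf Z_2$-algebras with a fixed identification of the residue field with $\mathbf F_2$. Let $R^{\mathrm{ps}}$, with universal determinant $D^{\mathrm{univ}}$ and trace $T^{\mathrm{univ}}$, be the complete local Noetherian $\mathbf Z_2$-algebra with residue field $\mathbf F_2$ that pro-represents the functor on $\mathcal C$ taking $A$ to the set of determinants of $G$ over $A$ of dimension $2$ that reduce to $D_{\bar\rho}$. Let $R^{\square}$, with universal lifting $\rho^{\mathrm{univ}}\colon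 G\to\mathrm{GL}_2(R^{\square})$, be the complete local Noetherian $\mathbf Z_2$-algebra with residue field $\mathbf F_2$ that pro-represents the functor taking $A$ to the set of homomorphisms $G\to\mathrm{GL}_2(A)$ that reduce to $\bar\rho$. Let $R^{\mathrm{coeff}}\subset R^{\square}$ be the $\mathbf Z_2$-subalgebra generated by the coefficients of the characteristic polynomials of $\rho^{\mathrm{univ}}(g)$, $g\in G$. **Theorem.** The universal pairs $(R^{\mathrm{ps}},D^{\mathrm{univ}})$ and $(R^{\square},\rho^{\mathrm{univ}})$ exist, and for any choice of them the following hold. 1. There is a unique $\mathbf Z_2$-algebra homomorphism $R^{\mathrm{ps}}\to R^{\mathrm{coeff}}$ whose composite with $R^{\mathrm{coeff}}\subset R^{\square}$ takes $D^{\mathrm{univ}}$ to $D_{\rho^{\mathrm{univ}}}$. It is surjective but not injective, and $R^{\mathrm{ps}}$ and $R^{\mathrm{coeff}}$ are not isomorphic as rings. 2. $T^{\mathrm{univ}}(a^2)-2\neq 0$ in $R^{\mathrm{ps}}$, while $\mathrm{tr}(\rho^{\mathrm{univ}}(a^2))-2=0$ in $R^{\mathrm{coeff}}$. 3. The determinant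 $D^{\mathrm{univ}}$ of the finite group $G$ does not come from a representation over any extension of $R^{\mathrm{ps}}$: for every commutative ring $B$, every injective ring homomorphism $R^{\mathrm{ps}}\to B$ and every representation $\sigma\colon G\to\mathrm{GL}_2(B)$, one has $D_\sigma\neq D^{\mathrm{univ}}\otimes_{R^{\mathrm{ps}}}B$. -/

import Mathlib

open scoped TensorProduct

universe u v w

noncomputable section

/-! ### Determinants (pseudorepresentations in the sense of Chenevier)

All groups to which these definitions are applied are finite with the discrete topology, so that
continuity conditions are empty. -/

/-- An `A`-valued determinant of dimension `d` on the group `G`: a polynomial law `A[G] → A` over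
`A` that is multiplicative and homogeneous of degree `d`. -/
structure GroupDet (A : Type u) [CommRing A] (G : Type w) [Group G] (d : ℕ)
    extends PolynomialLaw A (MonoidAlgebra A G) A where
  map_one' (S : Type u) [CommSemiring S] [Algebra A S] : toFun' S 1 = 1
  map_mul' (S : Type u) [CommSemiring S] [Algebra A S] (x y : S ⊗[A] MonoidAlgebra A G) :
    toFun' S (x * y) = toFun' S x * toFun' S y
  map_smul' (S : Type u) [CommSemiring S] [Algebra A S] (s : S)
    (x : S ⊗[A] MonoidAlgebra A G) : toFun' S (s • x) = s ^ d • toFun' S x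

namespace GroupDet

variable {A : Type u} [CommRing A] {G : Type w} [Group G] {d : ℕ}

/-- The map `S[G] → S` attached to a determinant over `A` and a commutative `A`-algebra `S`
(in any universe), through `S ⊗ A[G] = S[G]` and `S ⊗ A = S`. -/
def eval (D : GroupDet A G d) (S : Type v) [CommRing S] [Algebra A S]
    (x : MonoidAlgebra S G) : S :=
  TensorProduct.rid A S
    (D.toPolynomialLaw.toFun S (MonoidAlgebra.lift S (S ⊗[A] MonoidAlgebra A G) G
      (Algebra.TensorProduct.includeRight.toMonoidHom.comp (MonoidAlgebra.of A G)) x))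

/-- `D.SpecializesTo f D'` says that `D ⊗_A B = D'`, where `B` is an `A`-algebra through `f`: for
every commutative `B`-algebra `S`, the two maps `S[G] → S` given by `D'` and by `D` agree. -/
def SpecializesTo {B : Type v} [CommRing B] (D : GroupDet A G d) (f : A →+* B)
    (D' : GroupDet B G d) : Prop :=
  ∀ (S : Type v) [CommRing S] [Algebra B S] (x : MonoidAlgebra S G),
    letI : Algebra A S := ((algebraMap B S).comp f).toAlgebra
    D'.eval S x = D.eval S x

/-- The characteristic polynomial `P(D, g) = D(X - g) ∈ A[X]`. -/
def charpoly (D : GroupDet A G d) (g : G) : Polynomial A :=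
  D.eval (Polynomial A) (MonoidAlgebra.single 1 Polynomial.X - MonoidAlgebra.single g 1)

/-- The coefficients `Λ_i(g)` in `P(D, g) = ∑ i, (-1) ^ i Λ_i(g) X ^ (d - i)`. -/
def coeff (D : GroupDet A G d) (i : Fin (d + 1)) (g : G) : A :=
  (-1) ^ (i : ℕ) * (D.charpoly g).coeff (d - i)

/-- The trace `T = Λ_1` of a determinant of dimension two. -/
def trace (D : GroupDet A G 2) (g : G) : A := D.coeff 1 g

end GroupDet

/-! ### The determinant of a representation -/

section OfRep

variable {A : Type u} [CommRing A] {G : Type w} [Group G] {d : ℕ}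

/-- The extension `S ⊗ A[G] = S[G] → M_d(S)` by linearity of a representation `G → GL_d(A)`, for a
commutative `A`-algebra `S`. -/
def repAlgHom (ρ : G →* GL (Fin d) A) (S : Type v) [CommRing S] [Algebra A S] :
    S ⊗[A] MonoidAlgebra A G →ₐ[S] Matrix (Fin d) (Fin d) S :=
  AlgHom.liftEquiv A S (MonoidAlgebra A G) (Matrix (Fin d) (Fin d) S)
    (MonoidAlgebra.lift A (Matrix (Fin d) (Fin d) S) G
      ((Units.coeHom _).comp ((Matrix.GeneralLinearGroup.map (algebraMap A S)).comp ρ)))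

theorem repAlgHom_naturality (ρ : G →* GL (Fin d) A) {S : Type v} [CommRing S] [Algebra A S]
    {S' : Type v} [CommRing S'] [Algebra A S'] (φ : S →ₐ[A] S') (x : S ⊗[A] MonoidAlgebra A G) :
    repAlgHom ρ S' (φ.toLinearMap.rTensor (MonoidAlgebra A G) x) =
      φ.toRingHom.mapMatrix (repAlgHom ρ S x) := by
  induction x with
  | zero => simp
  | add x y hx hy => rw [map_add, map_add, hx, hy, map_add, map_add]
  | tmul s m =>
    induction m using MonoidAlgebra.induction_linear with
    | zero => simp
    | add m n hm hn =>
      rw [TensorProduct.tmul_add, map_add, map_add, hm, hn, map_add, map_add]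
    | single g a =>
      ext i j
      simp [repAlgHom]

/-- The determinant `D_ρ = det ∘ ρ` of a representation `ρ : G → GL_d(A)`. -/
def GroupDet.ofRep (ρ : G →* GL (Fin d) A) : GroupDet A G d where
  toFun' S _ _ x :=
    letI : CommRing S := (algebraMap A S).commSemiringToCommRing
    (Algebra.TensorProduct.rid A S S).symm (Matrix.det (repAlgHom ρ S x))
  isCompat' {S _ _ S' _ _} φ := by
    let _ : CommRing S := (algebraMap A S).commSemiringToCommRing
    let _ : CommRing S' := (algebraMap A S').commSemiringToCommRing
    funext x
    have h := congrArg Matrix.det (repAlgHom_naturality ρ φ x)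
    rw [← RingHom.map_det] at h
    change φ.toLinearMap.rTensor A ((Algebra.TensorProduct.rid A S S).symm
      (Matrix.det (repAlgHom ρ S x))) = (Algebra.TensorProduct.rid A S' S').symm
      (Matrix.det (repAlgHom ρ S' (φ.toLinearMap.rTensor (MonoidAlgebra A G) x)))
    rw [h]
    simp
  map_one' S _ _ := by
    let _ : CommRing S := (algebraMap A S).commSemiringToCommRing
    change (Algebra.TensorProduct.rid A S S).symm (Matrix.det (repAlgHom ρ S 1)) = 1
    rw [map_one, Matrix.det_one, map_one]
  map_mul' S _ _ x y := by
    simp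
  map_smul' S _ _ s x := by
    let _ : CommRing S := (algebraMap A S).commSemiringToCommRing
    change (Algebra.TensorProduct.rid A S S).symm (Matrix.det (repAlgHom ρ S (s • x))) =
      s ^ d • (Algebra.TensorProduct.rid A S S).symm (Matrix.det (repAlgHom ρ S x))
    rw [map_smul, Matrix.det_smul, Fintype.card_fin, ← smul_eq_mul, map_smul]

/-- On commutative `A`-algebras that are given as rings, `D_ρ` is the usual determinant. -/
theorem GroupDet.ofRep_toFun' (ρ : G →* GL (Fin d) A) (S : Type u) [i : CommRing S] [Algebra A S]
    (y : S ⊗[A] MonoidAlgebra A G) :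
    (GroupDet.ofRep ρ).toFun' S y =
      (TensorProduct.rid A S).symm (Matrix.det (repAlgHom ρ S y)) := by
  have h : i = (algebraMap A S).commSemiringToCommRing := CommRing.ext rfl rfl
  have key : ∀ (j : CommSemiring S) (a : @Algebra A S _ j.toSemiring) (i : CommRing S)
      (e : i.toCommSemiring = j) (hi : i = (algebraMap A S).commSemiringToCommRing)
      (y : S ⊗[A] MonoidAlgebra A G),
      (GroupDet.ofRep ρ).toFun' S y = (TensorProduct.rid A S).symm
        (by subst e; exact Matrix.det (repAlgHom ρ S y)) := by
    intro j a i e hi y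
    subst hi
    rfl
  exact key _ _ i rfl h y

end OfRep

/-! ### Coefficient rings and the deformation functors -/

/-- A local `ℤ_p`-algebra with a fixed identification of its residue field with `𝔽_p`
(recall that `W(𝔽_p) = ℤ_p`). -/
structure CoeffRing (p : ℕ) [Fact p.Prime] where
  carrier : Type
  [commRing : CommRing carrier]
  [algebra : Algebra ℤ_[p] carrier]
  [isLocalRing : IsLocalRing carrier]
  residueEquiv : IsLocalRing.ResidueField carrier ≃+* ZMod p

namespace CoeffRing

variable {p : ℕ} [Fact p.Prime]

instance : CoeSort (CoeffRing p) Type := ⟨CoeffRing.carrier⟩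

attribute [instance] CoeffRing.commRing CoeffRing.algebra CoeffRing.isLocalRing

/-- The reduction map `A → A / 𝔪_A = 𝔽_p`. -/
def red (A : CoeffRing p) : A →+* ZMod p :=
  (A.residueEquiv : IsLocalRing.ResidueField A →+* ZMod p).comp (IsLocalRing.residue A)

/-- Complete local Noetherian coefficient rings. -/
def IsCompleteNoetherian (A : CoeffRing p) : Prop :=
  IsNoetherianRing A ∧ IsAdicComplete (IsLocalRing.maximalIdeal A) A

/-- Morphisms of coefficient rings: `ℤ_p`-algebra homomorphisms that are compatible with the
reductions to `𝔽_p` (and hence local). -/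
structure Hom (A B : CoeffRing p) where
  toAlgHom : A →ₐ[ℤ_[p]] B
  red_comp : B.red.comp (toAlgHom : A →+* B) = A.red

/-- The ring homomorphism underlying a morphism of coefficient rings. -/
def Hom.toRingHom {A B : CoeffRing p} (f : Hom A B) : A →+* B := f.toAlgHom

end CoeffRing

section Universal

variable {p : ℕ} [Fact p.Prime] {G : Type w} [Group G] {d : ℕ}

/-- `(R, D)` is the universal pseudodeformation ring of the residual determinant `Dbar` together
with its universal determinant: `R` is a complete local Noetherian coefficient ring, `D` is a
determinant over `R` that reduces to `Dbar`, and `(R, D)` pro-represents the functor that takes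
an Artinian coefficient ring `A` to the set of `A`-valued determinants reducing to `Dbar`. -/
structure IsUniversalPseudodeformation (Dbar : GroupDet (ZMod p) G d) (R : CoeffRing p)
    (D : GroupDet R G d) : Prop where
  complete : R.IsCompleteNoetherian
  reduces : D.SpecializesTo R.red Dbar
  universal (A : CoeffRing p) (_ : IsArtinianRing A) (E : GroupDet A G d)
    (_ : E.SpecializesTo A.red Dbar) :
    ∃! f : CoeffRing.Hom R A, D.SpecializesTo f.toRingHom E

/-- `(R, ρ)` is the universal framed deformation ring of the residual representation `ρbar`
together with the universal lifting: `R` is a complete local Noetherian coefficient ring, `ρ`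
lifts `ρbar`, and `(R, ρ)` pro-represents the functor that takes an Artinian coefficient ring `A`
to the set of liftings of `ρbar` to `A`. -/
structure IsUniversalLifting (ρbar : G →* GL (Fin d) (ZMod p)) (R : CoeffRing p)
    (ρ : G →* GL (Fin d) R) : Prop where
  complete : R.IsCompleteNoetherian
  reduces : (Matrix.GeneralLinearGroup.map R.red).comp ρ = ρbar
  universal (A : CoeffRing p) (_ : IsArtinianRing A) (σ : G →* GL (Fin d) A)
    (_ : (Matrix.GeneralLinearGroup.map A.red).comp σ = ρbar) :
    ∃! f : CoeffRing.Hom R A, (Matrix.GeneralLinearGroup.map f.toRingHom).comp ρ = σ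

/-- The coefficient subring of a lifting: the `ℤ_p`-subalgebra generated by the coefficients of the
characteristic polynomials of the `ρ g`. -/
def coeffSubring {R : CoeffRing p} (ρ : G →* GL (Fin d) R) : Subalgebra ℤ_[p] R :=
  Algebra.adjoin ℤ_[p]
    {r | ∃ (g : G) (i : ℕ), r = (ρ g : Matrix (Fin d) (Fin d) R).charpoly.coeff i}

end Universal

/-! ### The extraspecial group `2_+^{1+4}` -/

/-- The names of the four generators. -/
inductive ExtraGen
  | a
  | b
  | c
  | d

open FreeGroup in
/-- The relations `a⁴ = b² = d² = 1`, `c² = a²`, `bab = a⁻¹`, `ac = ca`, `ad = da`, `bc = cb`,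
`bd = db`, `dcd = a²c`. -/
def extraRels : Set (FreeGroup ExtraGen) :=
  let a := of ExtraGen.a
  let b := of ExtraGen.b
  let c := of ExtraGen.c
  let d := of ExtraGen.d
  {a ^ 4, b ^ 2, d ^ 2, c ^ 2 * (a ^ 2)⁻¹, b * a * b * (a⁻¹)⁻¹, a * c * (c * a)⁻¹,
    a * d * (d * a)⁻¹, b * c * (c * b)⁻¹, b * d * (d * b)⁻¹, d * c * d * (a ^ 2 * c)⁻¹}

/-- The extraspecial group `2_+^{1+4}`, the central product of two dihedral groups of order 8. -/
abbrev ExtraspecialGroup : Type := PresentedGroup extraRels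

/-- The generator `a` of the extraspecial group. -/
def extraA : ExtraspecialGroup := PresentedGroup.of ExtraGen.a

end

/-! Everything turns on the central element `z = a²`, for which `ab = baz` and `cd = dcz`, while `a`
and `b` commute with `c`.

For matrices of size two this forces trace two. Modulo scalars a matrix is a vector with three
coordinates, the commutator of two matrices is their cross product, and matrices commute exactly
when their cross product vanishes. Since `c` is parallel to both `a` and `b`, every entry of `ab -
ba` kills every entry of `cd - dc`, over any commutative ring
(`Matrix.commutator_apply_mul_commutator_apply`). Dividing by `ba` and `dc`, all products of two
entries of `N = ρ(z) - 1` vanish. Hence `det N = 0`, and `1 = det ρ(z) = 1 + tr N + det N` gives `tr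
N = 0`.

Determinants only see traces and do not obey this constraint. A determinant of dimension two is the
same as a pair (trace, determinant) satisfying three identities (`GroupDet.toTraceDet`,
`TraceDet.toGroupDet`, `GroupDet.specializesTo_iff`). Any central extension of an elementary abelian
2-group `V` by `ℤ/2` carries such a pair with values in a local algebra over `𝔽₂` spanned by `1`,
elements `x_v`, and a socle element `s`, with `x_v² = s` and `x_v x_w = 0` for `v ≠ w`
(`CentralExt.traceDet`). There the nontrivial central element has trace `s ≠ 0 = 2`. Through a
normal form the group is identified with such an extension, with `z` the nontrivial central element,
so `T(z) ≠ 2` in the universal ring.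

For existence, the ring of all pairs on a finite 2-group is finite over `ℤ₂` and local, hence
already complete; it is the pseudodeformation ring. It maps onto the subring generated by traces and
determinants, which is the coefficient ring. The framed ring is the completion of the ring of all
representations at the residual one. Finally, an abstract isomorphism of the two rings would turn
the natural surjection into a surjective, non-injective endomorphism of a Noetherian ring. -/

noncomputable section

/-! ### Evaluation of determinants over algebras in every universe. -/

namespace GroupDet

variable {A : Type u} [CommRing A] {G : Type w} [Group G] {d : ℕ}

/-- The identification `S[G] → S ⊗ A[G]` through which determinants are evaluated. -/
def toTensor (A : Type u) [CommRing A] (G : Type w) [Group G] (S : Type v) [CommRing S]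
    [Algebra A S] : MonoidAlgebra S G →ₐ[S] S ⊗[A] MonoidAlgebra A G :=
  MonoidAlgebra.lift S (S ⊗[A] MonoidAlgebra A G) G
    (Algebra.TensorProduct.includeRight.toMonoidHom.comp (MonoidAlgebra.of A G))

theorem toTensor_single {S : Type v} [CommRing S] [Algebra A S] (g : G) (s : S) :
    toTensor A G S (MonoidAlgebra.single g s) = s ⊗ₜ MonoidAlgebra.single g 1 := by
  simp [toTensor, TensorProduct.smul_tmul']

theorem toTensor_surjective (S : Type v) [CommRing S] [Algebra A S] :
    Function.Surjective (toTensor A G S) := by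
  intro x
  induction x with
  | zero => exact ⟨0, map_zero _⟩
  | add x y hx hy =>
    obtain ⟨a, rfl⟩ := hx
    obtain ⟨b, rfl⟩ := hy
    exact ⟨a + b, map_add _ _ _⟩
  | tmul s m =>
    induction m using MonoidAlgebra.induction_linear with
    | zero => exact ⟨0, by simp⟩
    | add m n hm hn =>
      obtain ⟨a, ha⟩ := hm
      obtain ⟨b, hb⟩ := hn
      exact ⟨a + b, by rw [map_add, ha, hb, TensorProduct.tmul_add]⟩
    | single g a =>
      refine ⟨MonoidAlgebra.single g (a • s), ?_⟩
      rw [toTensor_single, TensorProduct.smul_tmul, MonoidAlgebra.smul_single, smul_eq_mul,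
        mul_one]

theorem rTensor_toTensor {S : Type v} [CommRing S] [Algebra A S] {S' : Type*} [CommRing S']
    [Algebra A S'] (φ : S →ₐ[A] S') (x : MonoidAlgebra S G) :
    φ.toLinearMap.rTensor (MonoidAlgebra A G) (toTensor A G S x) =
      toTensor A G S' (MonoidAlgebra.mapRingHom G (φ : S →+* S') x) := by
  induction x using MonoidAlgebra.induction_linear with
  | zero => simp
  | add x y hx hy => simp only [map_add, hx, hy]
  | single g s => simp [toTensor_single]

theorem eval_eq (D : GroupDet A G d) (S : Type v) [CommRing S] [Algebra A S]
    (x : MonoidAlgebra S G) :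
    D.eval S x = TensorProduct.rid A S (D.toPolynomialLaw.toFun S (toTensor A G S x)) := rfl

/-- Determinants are compatible with homomorphisms of algebras, in all universes. -/
theorem map_eval (D : GroupDet A G d) {S : Type v} [CommRing S] [Algebra A S] {S' : Type*}
    [CommRing S'] [Algebra A S'] (φ : S →ₐ[A] S') (x : MonoidAlgebra S G) :
    φ (D.eval S x) = D.eval S' (MonoidAlgebra.mapRingHom G (φ : S →+* S') x) := by
  rw [eval_eq, eval_eq, ← rTensor_toTensor, ← PolynomialLaw.isCompat_apply]
  generalize D.toPolynomialLaw.toFun S (toTensor A G S x) = y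
  induction y with
  | zero => simp
  | add x y hx hy => simp only [map_add, hx, hy]
  | tmul s a => simp

/-- Homogeneity is postulated only for algebras in the universe of `A`. The given element and scalar
both come from a polynomial ring over `A` in finitely many variables, which lies in that universe,
and compatibility with base change transports the identity. -/
theorem toFun_smul (D : GroupDet A G d) (S : Type v) [CommRing S] [Algebra A S] (s : S)
    (x : S ⊗[A] MonoidAlgebra A G) :
    D.toPolynomialLaw.toFun S (s • x) = s ^ d • D.toPolynomialLaw.toFun S x := by
  obtain ⟨n, ψ, p, q, rfl, rfl⟩ := PolynomialLaw.exists_lift' x s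
  have h : ψ q • ψ.toLinearMap.rTensor (MonoidAlgebra A G) p =
      ψ.toLinearMap.rTensor (MonoidAlgebra A G) (q • p) := by
    induction p with
    | zero => simp
    | add x y hx hy => simp only [smul_add, map_add, hx, hy]
    | tmul s a => simp [TensorProduct.smul_tmul']
  have h' (y : MvPolynomial (Fin n) A ⊗[A] A) : ψ q ^ d • ψ.toLinearMap.rTensor A y =
      ψ.toLinearMap.rTensor A (q ^ d • y) := by
    induction y with
    | zero => simp
    | add x y hx hy => simp only [smul_add, map_add, hx, hy]
    | tmul s a => simp [TensorProduct.smul_tmul']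
  rw [h, ← PolynomialLaw.isCompat_apply, ← PolynomialLaw.isCompat_apply, h',
    ← PolynomialLaw.toFun'_eq_toFun, D.map_smul']

theorem eval_smul (D : GroupDet A G d) (S : Type v) [CommRing S] [Algebra A S] (s : S)
    (x : MonoidAlgebra S G) : D.eval S (s • x) = s ^ d * D.eval S x := by
  rw [eval_eq, eval_eq, map_smul, toFun_smul]
  generalize D.toPolynomialLaw.toFun S (toTensor A G S x) = y
  induction y with
  | zero => simp
  | add x y hx hy => simp only [smul_add, map_add, hx, hy, mul_add]
  | tmul s a => simp [TensorProduct.smul_tmul']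

theorem eval_one (D : GroupDet A G d) : D.eval A 1 = 1 := by
  rw [eval_eq, map_one, ← PolynomialLaw.toFun'_eq_toFun, D.map_one',
    Algebra.TensorProduct.one_def, TensorProduct.rid_tmul, one_smul]

theorem eval_mul (D : GroupDet A G d) (x y : MonoidAlgebra A G) :
    D.eval A (x * y) = D.eval A x * D.eval A y := by
  rw [eval_eq, eval_eq, eval_eq, map_mul, ← PolynomialLaw.toFun'_eq_toFun, D.map_mul']
  exact map_mul (Algebra.TensorProduct.rid A A A) _ _

end GroupDet

/-! ### Determinants of dimension two as quadratic forms. -/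

namespace MvPolynomial

variable {A : Type*} [CommRing A] {σ : Type*}

/-- Evaluation of a homogeneous polynomial of degree two is a quadratic form. -/
theorem IsHomogeneous.exists_quadraticMap {p : MvPolynomial σ A} (hp : p.IsHomogeneous 2)
    (S : Type*) [CommRing S] [Algebra A S] :
    ∃ q : QuadraticMap S (σ → S) S, ∀ x, q x = MvPolynomial.aeval x p := by
  classical
  -- A monomial of degree two, read as a multiset of variables, has two elements, so it is a product
  -- `X i * X j` of two linear forms; `i = j` is allowed.
  have key : ∀ m ∈ p.support, ∃ q : QuadraticMap S (σ → S) S,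
      ∀ x, q x = MvPolynomial.aeval x (monomial m (p.coeff m)) := by
    intro m hm
    have hm2 : m.degree = 2 := by
      rw [Finsupp.degree_eq_weight_one]
      exact hp (mem_support_iff.mp hm)
    have hcard : (Finsupp.toMultiset m).card = 2 := by
      rw [Finsupp.card_toMultiset, ← hm2]; rfl
    obtain ⟨i, j, hij⟩ := Multiset.card_eq_two.mp hcard
    have hm' : m = Finsupp.single i 1 + Finsupp.single j 1 := by
      apply Multiset.toFinsupp.symm.injective
      change Finsupp.toMultiset m = Finsupp.toMultiset _
      rw [hij, map_add, Finsupp.toMultiset_single, Finsupp.toMultiset_single, one_smul, one_smul]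
      rfl
    refine ⟨algebraMap A S (p.coeff m) •
      QuadraticMap.linMulLin (LinearMap.proj i) (LinearMap.proj j), fun x => ?_⟩
    have hprod : (m.prod fun i k => x i ^ k) = x i * x j := by
      rw [hm', Finsupp.prod_add_index' (by simp) (by intros; exact pow_add _ _ _)]
      simp
    rw [aeval_monomial, hprod]
    simp [Algebra.smul_def]
  choose! q hq using key
  refine ⟨∑ m ∈ p.support, q m, fun x => ?_⟩
  conv_rhs => rw [p.as_sum]
  rw [map_sum, sum_apply]
  exact Finset.sum_congr rfl fun m hm => hq m hm x

end MvPolynomial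

end

noncomputable section

namespace MvPolynomial

variable {A : Type*} [CommRing A] {σ : Type*}

/-- Scaling all variables by `t` multiplies the part of degree `n` by `t ^ n`. This extracts
homogeneity of a polynomial from homogeneity of the law it defines. -/
theorem coeff_aeval_X_mul_C_X (p : MvPolynomial σ A) (n : ℕ) :
    (aeval (fun i => Polynomial.X * Polynomial.C (X i : MvPolynomial σ A)) p).coeff n =
      homogeneousComponent n p := by
  classical
  induction p using MvPolynomial.induction_on' with
  | add p q hp hq => rw [map_add, Polynomial.coeff_add, hp, hq, map_add]
  | monomial m a =>
    have h : aeval (fun i => Polynomial.X * Polynomial.C (X i : MvPolynomial σ A)) (monomial m a) =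
        Polynomial.C (monomial m a) * Polynomial.X ^ m.degree := by
      rw [aeval_monomial, monomial_eq, map_mul]
      simp only [mul_pow, Finsupp.prod, Finset.prod_mul_distrib, Finset.prod_pow_eq_pow_sum,
        map_prod, map_pow]
      rw [← mul_assoc, mul_right_comm]
      rfl
    rw [h, Polynomial.coeff_C_mul, Polynomial.coeff_X_pow]
    have hm : (monomial m a).IsHomogeneous m.degree := isHomogeneous_monomial _ rfl
    rw [homogeneousComponent_of_mem hm]
    split_ifs <;> simp

end MvPolynomial

namespace QuadraticMap

/-- Quadratic maps on a monoid algebra are determined by their values and their polar form on the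
basis. -/
theorem ext_monoidAlgebra {S G N : Type*} [CommRing S] [AddCommGroup N] [Module S N]
    {q q' : QuadraticMap S (MonoidAlgebra S G) N}
    (h : ∀ g, q (.single g 1) = q' (.single g 1))
    (hp : ∀ g g', polar q (.single g 1) (.single g' 1) = polar q' (.single g 1) (.single g' 1)) :
    q = q' := by
  have hb : q.polarBilin = q'.polarBilin := by
    refine MonoidAlgebra.lhom_ext' fun g => LinearMap.ext_ring ?_
    refine MonoidAlgebra.lhom_ext' fun g' => LinearMap.ext_ring ?_
    simpa using hp g g'
  ext x
  induction x using MonoidAlgebra.induction_linear with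
  | zero => simp
  | add x y hx hy =>
    rw [QuadraticMap.map_add q, QuadraticMap.map_add q', hx, hy]
    exact congrArg _ (congrArg (fun b => b x y) hb)
  | single g s =>
    have hs : MonoidAlgebra.single g s = s • MonoidAlgebra.single g 1 := by
      simp [MonoidAlgebra.smul_single]
    rw [hs, QuadraticMap.map_smul q, QuadraticMap.map_smul q', h]

end QuadraticMap

namespace GroupDet

variable {A : Type u} [CommRing A] {G : Type w} [Group G]

section

variable [Finite G] (D : GroupDet A G 2) (S : Type v) [CommRing S] [Algebra A S]

/-- A determinant of dimension two is a quadratic form. -/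
theorem exists_quadraticMap :
    ∃ q : QuadraticMap S (MonoidAlgebra S G) S, ∀ x, q x = D.eval S x := by
  classical
  cases nonempty_fintype G
  -- The value of `D` at the generic element `∑ X_g g`; every other value is obtained by
  -- specializing the variables.
  let P : MvPolynomial G A := D.eval (MvPolynomial G A)
    (∑ g, MonoidAlgebra.single g (MvPolynomial.X g))
  have hP {R : Type v} [CommRing R] [Algebra A R] (f : G → R) :
      D.eval R (∑ g, MonoidAlgebra.single g (f g)) = MvPolynomial.aeval f P := by
    rw [map_eval]
    simp
  have hhom : P.IsHomogeneous 2 := by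
    have h1 : MvPolynomial.aeval (fun i => Polynomial.X * Polynomial.C
        (MvPolynomial.X i : MvPolynomial G A)) P = Polynomial.X ^ 2 * Polynomial.C P := by
      have h2 := map_eval D (IsScalarTower.toAlgHom A (MvPolynomial G A)
        (Polynomial (MvPolynomial G A))) (∑ g, MonoidAlgebra.single g (MvPolynomial.X g))
      rw [map_eval, map_sum]
      have h3 : Polynomial.C P = D.eval (Polynomial (MvPolynomial G A))
          (∑ g, MonoidAlgebra.single g (Polynomial.C (MvPolynomial.X g))) := by
        rw [map_sum] at h2
        simpa using h2
      rw [h3, ← eval_smul]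
      simp [Finset.smul_sum, MonoidAlgebra.smul_single]
    have h4 := MvPolynomial.coeff_aeval_X_mul_C_X P 2
    rw [h1, mul_comm, Polynomial.coeff_C_mul, Polynomial.coeff_X_pow, if_pos rfl, mul_one] at h4
    rw [h4]
    exact MvPolynomial.homogeneousComponent_isHomogeneous _ _
  obtain ⟨q, hq⟩ := hhom.exists_quadraticMap S
  refine ⟨q.comp ((LinearMap.pi fun g => Finsupp.lapply g).comp
    (MonoidAlgebra.coeffLinearEquiv S).toLinearMap), fun x => ?_⟩
  have hx : x = ∑ g, MonoidAlgebra.single g (x.coeff g) := by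
    conv_lhs => rw [← x.sum_coeff_single]
    exact Finsupp.sum_fintype _ _ (by simp)
  rw [QuadraticMap.comp_apply, hq]
  conv_rhs => rw [hx, hP]
  rfl

/-- The quadratic form `S[G] → S` underlying a determinant of dimension two. -/
def quad : QuadraticMap S (MonoidAlgebra S G) S := (D.exists_quadraticMap S).choose

theorem quad_apply (x : MonoidAlgebra S G) : D.quad S x = D.eval S x :=
  (D.exists_quadraticMap S).choose_spec x

end

end GroupDet

end

/-! ### From determinants to trace-determinant pairs. -/

noncomputable section

open QuadraticMap (polar)

/-- A pair of functions on `G` with the properties of the trace and the determinant of a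
two-dimensional representation. -/
@[ext]
structure TraceDet (A : Type u) [CommRing A] (G : Type w) [Group G] where
  tr : G → A
  det : G →* A
  tr_one : tr 1 = 2
  tr_mul_comm (g h : G) : tr (g * h) = tr (h * g)
  -- This is the Cayley–Hamilton identity `g + det(g) g⁻¹ = tr(g)`, multiplied by `h` and traced.
  tr_mul_tr (g h : G) : tr g * tr h = tr (g * h) + det g * tr (g⁻¹ * h)

namespace GroupDet

variable {A : Type u} [CommRing A] {G : Type w} [Group G] (D : GroupDet A G 2)

theorem eval_mapRingHom {S : Type v} [CommRing S] [Algebra A S] (x : MonoidAlgebra A G) :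
    D.eval S (MonoidAlgebra.mapRingHom G (algebraMap A S) x) = algebraMap A S (D.eval A x) :=
  (D.map_eval (Algebra.ofId A S) x).symm

theorem eval_single_one {S : Type v} [CommRing S] [Algebra A S] (g : G) :
    D.eval S (.single g 1) = algebraMap A S (D.eval A (.single g 1)) := by
  rw [← eval_mapRingHom, MonoidAlgebra.mapRingHom_single, map_one]

variable [Finite G]

theorem polar_quad_mapRingHom {S : Type v} [CommRing S] [Algebra A S] (g h : G) :
    polar (D.quad S) (.single g 1) (.single h 1) =
      algebraMap A S (polar (D.quad A) (.single g 1) (.single h 1)) := by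
  have hs (g : G) : (MonoidAlgebra.single g 1 : MonoidAlgebra S G) =
      MonoidAlgebra.mapRingHom G (algebraMap A S) (.single g 1) := by simp
  simp only [polar, quad_apply, hs, ← map_add, eval_mapRingHom, ← map_sub]

theorem polar_mul_left (x y y' : MonoidAlgebra A G) :
    polar (D.quad A) (x * y) (x * y') = D.eval A x * polar (D.quad A) y y' := by
  simp only [polar, quad_apply, ← mul_add, eval_mul]
  ring

theorem polar_mul_right (x x' y : MonoidAlgebra A G) :
    polar (D.quad A) (x * y) (x' * y) = polar (D.quad A) x x' * D.eval A y := by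
  simp only [polar, quad_apply, ← add_mul, eval_mul]
  ring

/-- Multiplicativity polarized in both factors: polarizing in the right factor gives
`polar_mul_left`, and substituting `x + x'` there polarizes in the left one. -/
theorem polar_mul_add_polar_mul (x x' y y' : MonoidAlgebra A G) :
    polar (D.quad A) (x * y) (x' * y') + polar (D.quad A) (x * y') (x' * y) =
      polar (D.quad A) x x' * polar (D.quad A) y y' := by
  have h := D.polar_mul_left (x + x') y y'
  have hx : D.eval A (x + x') = D.eval A x + D.eval A x' + polar (D.quad A) x x' := by
    simp only [← quad_apply]
    exact QuadraticMap.map_add _ _ _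
  rw [add_mul, add_mul, QuadraticMap.polar_add_left, QuadraticMap.polar_add_right,
    QuadraticMap.polar_add_right, polar_mul_left, polar_mul_left, hx,
    QuadraticMap.polar_comm _ (x' * y)] at h
  linear_combination h

/-- The quadratic form at `X - g` expands as `X² D(1) - X · polar(1, g) + D(g)`. -/
theorem trace_eq_polar (g : G) : D.trace g = polar (D.quad A) 1 (.single g 1) := by
  have h : D.charpoly g = Polynomial.X ^ 2 - Polynomial.C (polar (D.quad A) 1 (.single g 1)) *
      Polynomial.X + Polynomial.C (D.eval A (.single g 1)) := by
    have hX : (MonoidAlgebra.single 1 Polynomial.X : MonoidAlgebra (Polynomial A) G) =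
        (Polynomial.X : Polynomial A) • .single 1 1 := by simp [MonoidAlgebra.smul_single]
    have h1 := D.polar_quad_mapRingHom (S := Polynomial A) 1 g
    have h2 := D.eval_single_one (S := Polynomial A) g
    have h3 := D.eval_single_one (S := Polynomial A) 1
    rw [← MonoidAlgebra.one_def, ← MonoidAlgebra.one_def, eval_one, map_one, ← quad_apply] at h3
    rw [← quad_apply] at h2
    rw [charpoly, hX, ← quad_apply, sub_eq_add_neg, QuadraticMap.map_add (D.quad _),
      QuadraticMap.map_smul, QuadraticMap.map_neg, QuadraticMap.polar_neg_right,
      QuadraticMap.polar_smul_left, h1, h2, ← MonoidAlgebra.one_def, h3, MonoidAlgebra.one_def]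
    simp only [Polynomial.algebraMap_eq, smul_eq_mul]
    ring
  rw [trace, coeff, h]
  simp

/-- The trace and the determinant of a determinant of dimension two. -/
def toTraceDet : TraceDet A G where
  tr := D.trace
  det :=
    { toFun g := D.eval A (.single g 1)
      map_one' := by rw [← MonoidAlgebra.one_def, eval_one]
      map_mul' g h := by rw [← eval_mul, MonoidAlgebra.single_mul_single, one_mul] }
  tr_one := by
    rw [trace_eq_polar, ← MonoidAlgebra.one_def, QuadraticMap.polar_self, quad_apply, eval_one]
    simp
  tr_mul_comm g h := by
    have hu : D.eval A (.single g⁻¹ 1) * D.eval A (.single g 1) = 1 := by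
      rw [← eval_mul, MonoidAlgebra.single_mul_single, inv_mul_cancel, one_mul,
        ← MonoidAlgebra.one_def, eval_one]
    -- The polar form at `(g, ghg)` is computed twice, pulling `g` out on the left and on the right;
    -- then the unit `D(g)` is cancelled.
    have h1 := D.polar_mul_left (.single g 1) 1 (.single (h * g) 1)
    have h2 := D.polar_mul_right 1 (.single (g * h) 1) (.single g 1)
    simp only [MonoidAlgebra.single_mul_single, mul_one, one_mul, ← mul_assoc,
      ← trace_eq_polar] at h1 h2
    rw [h1] at h2
    linear_combination (-D.eval A (.single g⁻¹ 1)) * h2 + (D.trace (h * g) - D.trace (g * h)) * hu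
  tr_mul_tr g h := by
    have h1 := D.polar_mul_add_polar_mul 1 (.single g 1) 1 (.single h 1)
    have h2 := D.polar_mul_left (.single g 1) 1 (.single (g⁻¹ * h) 1)
    simp only [MonoidAlgebra.single_mul_single, mul_one, one_mul, mul_inv_cancel_left,
      ← trace_eq_polar] at h1 h2
    rw [QuadraticMap.polar_comm] at h2
    change _ = _ + D.eval A (.single g 1) * _
    rw [← h1, h2]

theorem toTraceDet_tr (g : G) : D.toTraceDet.tr g = D.trace g := rfl

theorem toTraceDet_det (g : G) : D.toTraceDet.det g = D.eval A (.single g 1) := rfl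

theorem polar_quad (g h : G) : polar (D.quad A) (.single g 1) (.single h 1) =
    D.toTraceDet.det g * D.toTraceDet.tr (g⁻¹ * h) := by
  have h2 := D.polar_mul_left (.single g 1) 1 (.single (g⁻¹ * h) 1)
  simp only [MonoidAlgebra.single_mul_single, mul_one, mul_inv_cancel_left,
    ← trace_eq_polar] at h2
  exact h2

end GroupDet

theorem QuadraticMap.polar_comp_linearMap {R M M' N : Type*} [CommRing R] [AddCommGroup M]
    [Module R M] [AddCommGroup M'] [Module R M'] [AddCommGroup N] [Module R N]
    (q : QuadraticMap R M' N) (f : M →ₗ[R] M') (x y : M) :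
    polar (q.comp f) x y = polar q (f x) (f y) := by
  simp [polar]

namespace TraceDet

variable {A : Type u} [CommRing A] {G : Type w} [Group G]

/-- The image of a pair under a ring homomorphism. -/
def map {B : Type*} [CommRing B] (f : A →+* B) (P : TraceDet A G) : TraceDet B G where
  tr g := f (P.tr g)
  det := (f : A →* B).comp P.det
  tr_one := by rw [P.tr_one, map_ofNat]
  tr_mul_comm g h := by rw [P.tr_mul_comm]
  tr_mul_tr g h := by simp [← map_mul, P.tr_mul_tr]

theorem map_map {B C : Type*} [CommRing B] [CommRing C] (f : A →+* B) (f' : B →+* C)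
    (P : TraceDet A G) : (P.map f).map f' = P.map (f'.comp f) := rfl

variable (P : TraceDet A G)

theorem tr_eq_det_mul (g : G) : P.tr g = P.det g * P.tr g⁻¹ := by
  have h := P.tr_mul_tr g 1
  rw [P.tr_one, mul_one, mul_one] at h
  linear_combination h

/-- The polar form `(g, h) ↦ tr g * tr h - tr (g * h)` of the determinant. -/
def pol (g h : G) : A := P.det g * P.tr (g⁻¹ * h)

theorem pol_comm (g h : G) : P.pol g h = P.pol h g := by
  rw [pol, pol, P.tr_eq_det_mul (g⁻¹ * h), ← mul_assoc, ← map_mul, mul_inv_cancel_left,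
    mul_inv_rev, inv_inv]

theorem pol_self (g : G) : P.pol g g = 2 * P.det g := by
  rw [pol, inv_mul_cancel, tr_one, mul_comm]

theorem pol_mul_left (g x y : G) : P.pol (g * x) (g * y) = P.det g * P.pol x y := by
  rw [pol, pol, map_mul, mul_assoc]
  congr 3
  group

theorem pol_mul_right (g x y : G) : P.pol (x * g) (y * g) = P.det g * P.pol x y := by
  have h : P.tr ((x * g)⁻¹ * (y * g)) = P.tr (x⁻¹ * y) := by
    rw [mul_inv_rev, mul_assoc, P.tr_mul_comm]
    congr 1
    group
  rw [pol, pol, map_mul, h]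
  ring

/-- The trace identity for `y⁻¹y'` and the conjugate of `x⁻¹x'` by `y`, rewritten with the
invariance of the trace under conjugation. It recovers the doubly polarized form of
multiplicativity. -/
theorem pol_mul_add_pol_mul (x x' y y' : G) :
    P.pol (x * y) (x' * y') + P.pol (x * y') (x' * y) = P.pol x x' * P.pol y y' := by
  have h := P.tr_mul_tr (y⁻¹ * y') (y⁻¹ * (x⁻¹ * x') * y)
  have h1 : P.tr (y⁻¹ * (x⁻¹ * x') * y) = P.tr (x⁻¹ * x') := by
    rw [P.tr_mul_comm, mul_inv_cancel_left]
  have h2 : P.tr (y⁻¹ * y' * (y⁻¹ * (x⁻¹ * x') * y)) = P.tr ((x * y)⁻¹ * (x' * y')) := by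
    rw [P.tr_mul_comm]
    congr 1
    group
  have h3 : (y⁻¹ * y')⁻¹ * (y⁻¹ * (x⁻¹ * x') * y) = (x * y')⁻¹ * (x' * y) := by group
  rw [h1, h2, h3] at h
  have h4 : P.det y * P.det (y⁻¹ * y') = P.det y' := by rw [← map_mul, mul_inv_cancel_left]
  simp only [pol, map_mul P.det x]
  linear_combination (-P.det x * P.det y) * h -
    P.det x * P.tr ((x * y')⁻¹ * (x' * y)) * h4

open LinearMap in
/-- Quadratic forms on the group algebra with the right values and the right polar form are
multiplicative. -/
theorem map_mul_of_polar {q : QuadraticMap A (MonoidAlgebra A G) A}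
    (hq : ∀ g, q (.single g 1) = P.det g)
    (hp : ∀ g h, polar q (.single g 1) (.single h 1) = P.pol g h) (x y : MonoidAlgebra A G) :
    q (x * y) = q x * q y := by
  -- Multiplicativity is reduced to the basis one factor at a time. For `x` in the basis, `h1` and
  -- its polarization `h2` are equalities of quadratic forms in `y`; for fixed `y` they become the
  -- basis check for the equality `h3` of forms in `x`.
  have h1 (g : G) : q.comp (mulLeft A (.single g 1)) = P.det g • q := by
    refine QuadraticMap.ext_monoidAlgebra (fun k => ?_) fun k l => ?_
    · simp [MonoidAlgebra.single_mul_single, hq]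
    · rw [FunLike.coe_smul, QuadraticMap.polar_smul, hp]
      rw [QuadraticMap.polar_comp_linearMap, mulLeft_apply, mulLeft_apply,
        MonoidAlgebra.single_mul_single, MonoidAlgebra.single_mul_single, mul_one, hp,
        pol_mul_left, smul_eq_mul]
  have h2 (g h : G) : BilinMap.toQuadraticMap (q.polarBilin.compl₁₂
      (mulLeft A (.single g 1)) (mulLeft A (.single h 1))) = P.pol g h • q := by
    refine QuadraticMap.ext_monoidAlgebra (fun k => ?_) fun k l => ?_
    · simp [MonoidAlgebra.single_mul_single, hq, hp, pol_mul_right, mul_comm]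
    · rw [FunLike.coe_smul, QuadraticMap.polar_smul, hp, BilinMap.polar_toQuadraticMap]
      simp [MonoidAlgebra.single_mul_single, hp, pol_mul_add_pol_mul]
  have h3 : q.comp (mulRight A y) = q y • q := by
    refine QuadraticMap.ext_monoidAlgebra (fun g => ?_) fun g h => ?_
    · have := congrArg (fun q => q y) (h1 g)
      simpa [hq, mul_comm] using this
    · have := congrArg (fun q => q y) (h2 g h)
      rw [FunLike.coe_smul, QuadraticMap.polar_smul, hp, QuadraticMap.polar_comp_linearMap]
      simpa [mul_comm] using this
  have := congrArg (fun q => q x) h3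
  simpa [mul_comm] using this

end TraceDet

end

/-! ### From trace-determinant pairs back to determinants. -/

noncomputable section

open QuadraticMap (polar)

namespace TraceDet

variable {A : Type u} [CommRing A] {G : Type w} [Group G] (P : TraceDet A G)

open Classical in
/-- A bilinear form on the basis whose symmetrization is `P.pol`. -/
def halfPol (g h : G) : A :=
  if g = h then P.det g else if WellOrderingRel g h then P.pol g h else 0

theorem halfPol_self (g : G) : P.halfPol g g = P.det g := if_pos rfl

/-- As `2` need not be invertible, the quadratic form cannot be half of its polar form. A well-order
on `G` puts the whole polar form on one side of the diagonal instead, and `pol_self` makes the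
diagonal consistent. -/
theorem halfPol_add_halfPol (g h : G) : P.halfPol g h + P.halfPol h g = P.pol g h := by
  by_cases hgh : g = h
  · subst hgh
    rw [halfPol_self, pol_self, two_mul]
  · rw [halfPol, halfPol, if_neg hgh, if_neg (Ne.symm hgh)]
    rcases trichotomous_of WellOrderingRel g h with h1 | h1 | h1
    · rw [if_pos h1, if_neg (asymm h1), add_zero]
    · exact absurd h1 hgh
    · rw [if_pos h1, if_neg (asymm h1), zero_add, P.pol_comm]

/-- A bilinear form on the group algebra whose diagonal is the determinant attached to `P`. -/
def bilin : LinearMap.BilinForm A (MonoidAlgebra A G) :=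
  (Finsupp.linearCombination A fun g => (Finsupp.linearCombination A (P.halfPol g)).comp
    (MonoidAlgebra.coeffLinearEquiv A).toLinearMap).comp
    (MonoidAlgebra.coeffLinearEquiv A).toLinearMap

theorem bilin_single (g h : G) : P.bilin (.single g 1) (.single h 1) = P.halfPol g h := by
  simp [bilin, MonoidAlgebra.coeffLinearEquiv]

theorem bilin_naturality {S S' : Type*} [CommSemiring S] [Algebra A S] [CommSemiring S']
    [Algebra A S'] (φ : S →ₐ[A] S') (x y : S ⊗[A] MonoidAlgebra A G) :
    φ (P.bilin.baseChange S x y) = P.bilin.baseChange S' (φ.toLinearMap.rTensor _ x)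
      (φ.toLinearMap.rTensor _ y) := by
  induction x with
  | zero => simp
  | add x x' hx hx' => simp only [map_add, LinearMap.add_apply, hx, hx']
  | tmul s m =>
    induction y with
    | zero => simp
    | add y y' hy hy' => simp only [map_add, hy, hy']
    | tmul s' m' => simp

/-- The quadratic form on `S[G]` attached to `P`. -/
def form (S : Type v) [CommRing S] [Algebra A S] : QuadraticMap S (MonoidAlgebra S G) S :=
  (LinearMap.BilinMap.toQuadraticMap (P.bilin.baseChange S)).comp
    (GroupDet.toTensor A G S).toLinearMap

theorem form_apply (S : Type v) [CommRing S] [Algebra A S] (x : MonoidAlgebra S G) :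
    P.form S x = P.bilin.baseChange S (GroupDet.toTensor A G S x) (GroupDet.toTensor A G S x) :=
  rfl

theorem form_single (S : Type v) [CommRing S] [Algebra A S] (g : G) :
    P.form S (.single g 1) = algebraMap A S (P.det g) := by
  rw [form_apply, GroupDet.toTensor_single, LinearMap.BilinForm.baseChange_tmul, bilin_single,
    halfPol_self, mul_one, Algebra.algebraMap_eq_smul_one]

theorem polar_form (S : Type v) [CommRing S] [Algebra A S] (g h : G) :
    polar (P.form S) (.single g 1) (.single h 1) = algebraMap A S (P.pol g h) := by
  rw [form, QuadraticMap.polar_comp_linearMap, LinearMap.BilinMap.polar_toQuadraticMap]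
  simp only [AlgHom.toLinearMap_apply, GroupDet.toTensor_single,
    LinearMap.BilinForm.baseChange_tmul, bilin_single]
  rw [← halfPol_add_halfPol, mul_one, ← add_smul, Algebra.algebraMap_eq_smul_one]

theorem form_mul (S : Type v) [CommRing S] [Algebra A S] (x y : MonoidAlgebra S G) :
    P.form S (x * y) = P.form S x * P.form S y :=
  (P.map (algebraMap A S)).map_mul_of_polar (P.form_single S)
    (fun g h => by rw [polar_form, pol, pol, map_mul]; rfl) x y

/-- The determinant with given trace and determinant. -/
def toGroupDet : GroupDet A G 2 where
  toFun' S _ _ x := P.bilin.baseChange S x x ⊗ₜ 1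
  isCompat' φ := by
    funext x
    simp [← bilin_naturality]
  map_one' S _ _ := by
    rw [Algebra.TensorProduct.one_def, MonoidAlgebra.one_def,
      LinearMap.BilinForm.baseChange_tmul, bilin_single, halfPol_self, map_one, one_smul, one_mul,
      Algebra.TensorProduct.one_def]
  map_mul' S _ _ x y := by
    -- A commutative semiring that is an algebra over a ring has negatives, so `form_mul` applies to
    -- it.
    let _ : CommRing S := (algebraMap A S).commSemiringToCommRing
    obtain ⟨x, rfl⟩ := GroupDet.toTensor_surjective S x
    obtain ⟨y, rfl⟩ := GroupDet.toTensor_surjective S y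
    have h := P.form_mul S x y
    rw [form_apply, form_apply, form_apply, map_mul] at h
    rw [Algebra.TensorProduct.tmul_mul_tmul, one_mul]
    exact congrArg (· ⊗ₜ[A] (1 : A)) h
  map_smul' S _ _ s x := by
    simp [TensorProduct.smul_tmul', pow_two, mul_assoc]

theorem eval_toGroupDet (S : Type u) [CommRing S] [Algebra A S] (x : MonoidAlgebra S G) :
    P.toGroupDet.eval S x = P.form S x := by
  rw [GroupDet.eval_eq, ← PolynomialLaw.toFun'_eq_toFun]
  change TensorProduct.rid A S (P.bilin.baseChange S _ _ ⊗ₜ 1) = _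
  rw [TensorProduct.rid_tmul, one_smul, form_apply]

theorem toTraceDet_toGroupDet [Finite G] : P.toGroupDet.toTraceDet = P := by
  have hq : P.toGroupDet.quad A = P.form A := by
    ext x
    rw [GroupDet.quad_apply, eval_toGroupDet]
  ext g
  · rw [GroupDet.toTraceDet_tr, GroupDet.trace_eq_polar, hq, MonoidAlgebra.one_def, polar_form,
      pol, inv_one, one_mul, map_one, one_mul]
    rfl
  · rw [GroupDet.toTraceDet_det, eval_toGroupDet, form_single]
    rfl

end TraceDet

namespace GroupDet

variable {A : Type u} [CommRing A] {G : Type w} [Group G]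

theorem eval_ofRep {d : ℕ} (ρ : G →* GL (Fin d) A) (x : MonoidAlgebra A G) :
    (ofRep ρ).eval A x = (repAlgHom ρ A (toTensor A G A x)).det := by
  rw [eval_eq, ← PolynomialLaw.toFun'_eq_toFun, ofRep_toFun', LinearEquiv.apply_symm_apply]

theorem repAlgHom_toTensor_single {d : ℕ} (ρ : G →* GL (Fin d) A) (g : G) :
    repAlgHom ρ A (toTensor A G A (.single g 1)) = ρ g := by
  rw [toTensor_single]
  ext i j
  simp [repAlgHom]

variable [Finite G]

/-- Specialization of determinants in terms of trace and determinant. -/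
theorem specializesTo_iff {B : Type v} [CommRing B] (D : GroupDet A G 2) (f : A →+* B)
    (D' : GroupDet B G 2) : D.SpecializesTo f D' ↔ D'.toTraceDet = D.toTraceDet.map f := by
  constructor
  · intro h
    let _ : Algebra A B := f.toAlgebra
    have h' (x : MonoidAlgebra B G) : D'.eval B x = D.eval B x := h B x
    have hq : D'.quad B = D.quad B := by
      ext x
      rw [quad_apply, quad_apply, h']
    ext g
    · rw [toTraceDet_tr, trace_eq_polar, hq, MonoidAlgebra.one_def, polar_quad_mapRingHom,
        ← MonoidAlgebra.one_def, ← trace_eq_polar]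
      rfl
    · rw [toTraceDet_det, h', eval_single_one]
      rfl
  · intro h S _ _ x
    let _ : Algebra A S := ((algebraMap B S).comp f).toAlgebra
    change D'.eval S x = D.eval S x
    rw [← quad_apply, ← quad_apply]
    suffices hq : D'.quad S = D.quad S by rw [hq]
    refine QuadraticMap.ext_monoidAlgebra (fun g => ?_) fun g g' => ?_
    · rw [quad_apply, quad_apply, eval_single_one D', eval_single_one D]
      exact congrArg (fun P => algebraMap B S (P.det g)) h
    · rw [polar_quad_mapRingHom D', polar_quad_mapRingHom D, polar_quad, polar_quad, h,
        RingHom.algebraMap_toAlgebra, RingHom.comp_apply, map_mul f]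
      rfl

theorem toTraceDet_ofRep_det (ρ : G →* GL (Fin 2) A) (g : G) :
    (ofRep ρ).toTraceDet.det g = (ρ g : Matrix (Fin 2) (Fin 2) A).det := by
  rw [toTraceDet_det, eval_ofRep, repAlgHom_toTensor_single]

theorem toTraceDet_ofRep_tr (ρ : G →* GL (Fin 2) A) (g : G) :
    (ofRep ρ).toTraceDet.tr g = (ρ g : Matrix (Fin 2) (Fin 2) A).trace := by
  rw [toTraceDet_tr, trace_eq_polar, polar, quad_apply, quad_apply, quad_apply, eval_ofRep,
    eval_ofRep, eval_ofRep, map_add, map_add, repAlgHom_toTensor_single, map_one, map_one,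
    Matrix.det_fin_two, Matrix.det_one, Matrix.det_fin_two, Matrix.trace_fin_two]
  simp
  ring

end GroupDet

end

/-! ### Coefficient rings, truncations and limits. -/

noncomputable section

open IsLocalRing

namespace CoeffRing

variable {p : ℕ} [Fact p.Prime]

/-- The kernel must be the maximal ideal, and `𝔽_p` has no nontrivial automorphism. Compatibility
with reductions is therefore automatic for all algebra homomorphisms below. -/
theorem ringHom_zmod_ext {A : Type*} [CommRing A] [IsLocalRing A] (f g : A →+* ZMod p) :
    f = g := by
  have h (f : A →+* ZMod p) : RingHom.ker f = maximalIdeal A :=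
    have := RingHom.ker_isMaximal_of_surjective f (ZMod.ringHom_surjective f)
    eq_maximalIdeal this
  exact ZMod.ringHom_eq_of_ker_eq f g (by rw [h, h])

theorem ker_red (A : CoeffRing p) : RingHom.ker A.red = maximalIdeal A :=
  have := RingHom.ker_isMaximal_of_surjective A.red (ZMod.ringHom_surjective _)
  eq_maximalIdeal this

/-- Coefficient rings from local rings with a homomorphism to `𝔽_p`. -/
def ofRingHom (A : Type) [CommRing A] [Algebra ℤ_[p] A] [IsLocalRing A] (f : A →+* ZMod p) :
    CoeffRing p where
  carrier := A
  residueEquiv :=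
    haveI : IsLocalHom f := by
      refine ⟨fun a ha => ?_⟩
      by_contra h
      have hk : RingHom.ker f = maximalIdeal A :=
        have := RingHom.ker_isMaximal_of_surjective f (ZMod.ringHom_surjective f)
        eq_maximalIdeal this
      have : f a = 0 := by
        rw [← RingHom.mem_ker, hk]
        exact h
      exact not_isUnit_zero (this ▸ ha)
    RingEquiv.ofBijective (ResidueField.lift f)
      ⟨RingHom.injective _, ZMod.ringHom_surjective _⟩

/-- Algebra homomorphisms are automatically compatible with the reductions. -/
def Hom.ofAlgHom {A B : CoeffRing p} (f : A →ₐ[ℤ_[p]] B) : Hom A B :=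
  ⟨f, ringHom_zmod_ext _ _⟩

theorem Hom.ext {A B : CoeffRing p} {f g : Hom A B} (h : f.toAlgHom = g.toAlgHom) : f = g := by
  cases f
  cases g
  congr

/-- The truncation `A / 𝔪 ^ (n + 1)`. -/
def trunc (A : CoeffRing p) (n : ℕ) : CoeffRing p :=
  have hle : maximalIdeal A ^ (n + 1) ≤ maximalIdeal A := Ideal.pow_le_self n.succ_ne_zero
  haveI : Nontrivial (A ⧸ maximalIdeal A ^ (n + 1)) :=
    Ideal.Quotient.nontrivial_iff.mpr fun h =>
      (Ideal.IsPrime.ne_top inferInstance) (top_le_iff.mp (h ▸ hle))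
  haveI : IsLocalRing (A ⧸ maximalIdeal A ^ (n + 1)) :=
    .of_surjective' (Ideal.Quotient.mk _) Ideal.Quotient.mk_surjective
  ofRingHom (A ⧸ maximalIdeal A ^ (n + 1)) (Ideal.Quotient.lift _ A.red fun a ha => by
    rw [← RingHom.mem_ker, A.ker_red]
    exact hle ha)

/-- The projection to a truncation. -/
def toTrunc (A : CoeffRing p) (n : ℕ) : A →ₐ[ℤ_[p]] A.trunc n :=
  Ideal.Quotient.mkₐ ℤ_[p] (maximalIdeal A ^ (n + 1))

theorem isArtinianRing_trunc {A : CoeffRing p} (hA : A.IsCompleteNoetherian) (n : ℕ) :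
    IsArtinianRing (A.trunc n) := by
  have := hA.1
  have hsurj : Function.Surjective (A.toTrunc n : A →+* A.trunc n) := Ideal.Quotient.mk_surjective
  have : IsNoetherianRing (A.trunc n) := isNoetherianRing_of_surjective _ _ _ hsurj
  rw [isArtinianRing_iff_isNilpotent_maximalIdeal]
  refine ⟨n + 1, ?_⟩
  have hmap : maximalIdeal (A.trunc n) = (maximalIdeal A).map (A.toTrunc n : A →+* A.trunc n) := by
    have hc : (maximalIdeal (A.trunc n)).comap (A.toTrunc n : A →+* A.trunc n) =
        maximalIdeal A :=
      have := Ideal.comap_isMaximal_of_surjective (K := maximalIdeal (A.trunc n))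
        (A.toTrunc n : A →+* A.trunc n) hsurj
      eq_maximalIdeal this
    rw [← hc, Ideal.map_comap_of_surjective _ hsurj]
  rw [hmap, ← Ideal.map_pow]
  exact Ideal.map_quotient_self _

/-- Compatible homomorphisms to the truncations of a complete ring lift. -/
theorem exists_lift {R A : CoeffRing p} (hA : A.IsCompleteNoetherian)
    (f : ∀ n, R →ₐ[ℤ_[p]] A.trunc n)
    (hf : ∀ m n, m ≤ n → ∀ x y, A.toTrunc n y = f n x → A.toTrunc m y = f m x) :
    ∃ F : R →ₐ[ℤ_[p]] A, ∀ n, (A.toTrunc n).comp F = f n := by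
  have := hA.2
  -- `trunc n` is the quotient by the power `n + 1`, so that it is never zero; the limit is taken
  -- over the quotients by the power `n`, hence the shift.
  let f' (n : ℕ) : R →ₐ[ℤ_[p]] A ⧸ maximalIdeal A ^ n :=
    (Ideal.Quotient.factorₐ ℤ_[p] (Ideal.pow_le_pow_right n.le_succ)).comp (f n)
  have hf' (n : ℕ) (x : R) (y : A) (h : A.toTrunc n y = f n x) :
      f' n x = Ideal.Quotient.mk _ y := by
    change Ideal.Quotient.factorₐ ℤ_[p] (Ideal.pow_le_pow_right n.le_succ) (f n x) = _
    rw [← h]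
    rfl
  have hcomp {m n : ℕ} (hle : m ≤ n) :
      (Ideal.Quotient.factorₐ ℤ_[p] (Ideal.pow_le_pow_right hle)).comp (f' n) = f' m := by
    ext x
    obtain ⟨y, hy⟩ := Ideal.Quotient.mk_surjective (f n x)
    have hy' : A.toTrunc n y = f n x := hy
    rw [AlgHom.comp_apply, hf' n x y hy', hf' m x y (hf m n hle x y hy')]
    rfl
  refine ⟨IsAdicComplete.liftAlgHom (maximalIdeal A) f' hcomp, fun n => AlgHom.ext fun x => ?_⟩
  have h1 := IsAdicComplete.mk_liftAlgHom (maximalIdeal A) f' hcomp (n + 1) x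
  obtain ⟨y, hy⟩ := Ideal.Quotient.mk_surjective (f (n + 1) x)
  refine (h1.trans (hf' (n + 1) x y hy)).trans ?_
  exact hf n (n + 1) n.le_succ x y hy

theorem eq_of_toTrunc {A : CoeffRing p} (hA : A.IsCompleteNoetherian) {x y : A}
    (h : ∀ n, A.toTrunc n x = A.toTrunc n y) : x = y := by
  have := hA.2
  refine (IsHausdorff.eq_iff_smodEq (I := maximalIdeal A)).mpr fun n => ?_
  have hn : Ideal.Quotient.mk (maximalIdeal A ^ (n + 1)) x = Ideal.Quotient.mk _ y := h n
  rw [Ideal.Quotient.eq] at hn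
  rw [SModEq.sub_mem, smul_eq_mul, Ideal.mul_top]
  exact Ideal.pow_le_pow_right n.le_succ hn

end CoeffRing

namespace IsUniversalPseudodeformation

variable {p : ℕ} [Fact p.Prime] {G : Type w} [Group G] [Finite G] {Dbar : GroupDet (ZMod p) G 2}
  {R : CoeffRing p} {D : GroupDet R G 2}

theorem existsUnique_algHom (hR : IsUniversalPseudodeformation Dbar R D) (A : CoeffRing p)
    (hA : IsArtinianRing A) (P : TraceDet A G) (hP : P.map A.red = Dbar.toTraceDet) :
    ∃! f : R →ₐ[ℤ_[p]] A, D.toTraceDet.map (f : R →+* A) = P := by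
  obtain ⟨f, hf, huniq⟩ := hR.universal A hA P.toGroupDet (by
    rw [GroupDet.specializesTo_iff, P.toTraceDet_toGroupDet, hP])
  simp only [GroupDet.specializesTo_iff, P.toTraceDet_toGroupDet] at hf huniq
  refine ⟨f.toAlgHom, hf.symm, fun g hg => ?_⟩
  exact congrArg CoeffRing.Hom.toAlgHom (huniq (.ofAlgHom g) hg.symm)

theorem map_red (hR : IsUniversalPseudodeformation Dbar R D) :
    D.toTraceDet.map R.red = Dbar.toTraceDet :=
  ((GroupDet.specializesTo_iff _ _ _).mp hR.reduces).symm

/-- The universal property extends to complete coefficient rings. -/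
theorem existsUnique_algHom_of_complete (hR : IsUniversalPseudodeformation Dbar R D)
    {A : CoeffRing p} (hA : A.IsCompleteNoetherian) (P : TraceDet A G)
    (hP : P.map A.red = Dbar.toTraceDet) :
    ∃! f : R →ₐ[ℤ_[p]] A, D.toTraceDet.map (f : R →+* A) = P := by
  have key (n : ℕ) := hR.existsUnique_algHom (A.trunc n) (CoeffRing.isArtinianRing_trunc hA n)
    (P.map (A.toTrunc n : A →+* A.trunc n)) (by
      rw [TraceDet.map_map, CoeffRing.ringHom_zmod_ext ((A.trunc n).red.comp _) A.red, hP])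
  choose f hf huniq using key
  obtain ⟨F, hF⟩ := CoeffRing.exists_lift hA f (fun m n h x y hxy => by
    let t : A.trunc n →ₐ[ℤ_[p]] A.trunc m :=
      Ideal.Quotient.factorₐ ℤ_[p] (Ideal.pow_le_pow_right (Nat.succ_le_succ h))
    have ht : t.comp (A.toTrunc n) = A.toTrunc m := rfl
    -- Uniqueness over the Artinian ring `trunc m` makes the classifying maps compatible.
    have h1 : t.comp (f n) = f m := huniq m _ (by
      have := congrArg (TraceDet.map (t : A.trunc n →+* A.trunc m)) (hf n)
      exact this)
    rw [← ht, ← h1, AlgHom.comp_apply, AlgHom.comp_apply, hxy])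
  refine ⟨F, ?_, fun g hg => ?_⟩
  · have h2 (n : ℕ) : (D.toTraceDet.map (F : R →+* A)).map (A.toTrunc n : A →+* A.trunc n) =
        P.map (A.toTrunc n : A →+* A.trunc n) := by
      rw [← hf n, ← hF n]
      rfl
    ext g
    · exact CoeffRing.eq_of_toTrunc hA fun n => congrFun (congrArg TraceDet.tr (h2 n)) g
    · exact CoeffRing.eq_of_toTrunc hA fun n => DFunLike.congr_fun (congrArg TraceDet.det (h2 n)) g
  · refine AlgHom.ext fun x => CoeffRing.eq_of_toTrunc hA fun n => ?_
    have h3 : (A.toTrunc n).comp g = f n := huniq n _ (by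
      rw [← hg]
      rfl)
    exact DFunLike.congr_fun (h3.trans (hF n).symm) x

end IsUniversalPseudodeformation

end

/-! ### The ring that classifies trace-determinant pairs. -/

noncomputable section

open IsLocalRing

namespace TraceDet

section

variable (k : Type u) [CommRing k] (G : Type w) [Group G]

/-- The relations between the values of a universal pair. -/
def rels : Set (MvPolynomial (G ⊕ G) k) :=
  let T (g : G) : MvPolynomial (G ⊕ G) k := .X (.inl g)
  let N (g : G) : MvPolynomial (G ⊕ G) k := .X (.inr g)
  {r | r = T 1 - 2 ∨ r = N 1 - 1 ∨ ∃ g h, r = N (g * h) - N g * N h ∨ r = T (g * h) - T (h * g) ∨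
    r = T g * T h - (T (g * h) + N g * T (g⁻¹ * h))}

/-- The `k`-algebra that represents the functor of all trace-determinant pairs on `G`. -/
abbrev UniversalRing : Type max u w := MvPolynomial (G ⊕ G) k ⧸ Ideal.span (rels k G)

variable {G} in
theorem mk_eq_of_rels {x y : MvPolynomial (G ⊕ G) k} (h : x - y ∈ rels k G) :
    Ideal.Quotient.mk (Ideal.span (rels k G)) x = Ideal.Quotient.mk _ y :=
  Ideal.Quotient.eq.mpr (Ideal.subset_span h)

/-- The universal pair. -/
def univ : TraceDet (UniversalRing k G) G where
  tr g := Ideal.Quotient.mk _ (.X (.inl g))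
  det :=
    { toFun g := Ideal.Quotient.mk _ (.X (.inr g))
      map_one' := by
        rw [mk_eq_of_rels k (y := 1) (.inr (.inl rfl)), map_one]
      map_mul' g h := by
        rw [mk_eq_of_rels k (.inr (.inr ⟨g, h, .inl rfl⟩)), map_mul] }
  tr_one := by
    rw [mk_eq_of_rels k (y := 2) (.inl rfl), map_ofNat]
  tr_mul_comm g h := mk_eq_of_rels k (.inr (.inr ⟨g, h, .inr (.inl rfl)⟩))
  tr_mul_tr g h := by
    rw [← map_mul, mk_eq_of_rels k (.inr (.inr ⟨g, h, .inr (.inr rfl)⟩)), map_add, map_mul]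
    rfl

end

variable {k : Type u} [CommRing k] {G : Type w} [Group G] {A : Type*} [CommRing A] [Algebra k A]

/-- The homomorphism from the universal ring that classifies a pair. -/
def lift (P : TraceDet A G) : UniversalRing k G →ₐ[k] A :=
  Ideal.Quotient.liftₐ _ (MvPolynomial.aeval (Sum.elim P.tr P.det)) fun a ha => by
    refine Submodule.span_induction (p := fun a _ => MvPolynomial.aeval (Sum.elim P.tr P.det) a = 0)
      ?_ (map_zero _) ?_ ?_ ha
    · rintro r (rfl | rfl | ⟨g, h, rfl | rfl | rfl⟩)
      · simp [P.tr_one, map_ofNat]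
      · simp
      · simp
      · simp [P.tr_mul_comm g h]
      · simp [P.tr_mul_tr g h]
    · intro x y _ _ hx hy
      rw [map_add, hx, hy, add_zero]
    · intro a x _ hx
      rw [smul_eq_mul, map_mul, hx, mul_zero]

theorem map_lift_univ (P : TraceDet A G) :
    (univ k G).map (P.lift : UniversalRing k G →ₐ[k] A).toRingHom = P := by
  ext g
  · exact (MvPolynomial.aeval_X _ _)
  · exact (MvPolynomial.aeval_X _ _)

theorem algHom_ext {f f' : UniversalRing k G →ₐ[k] A}
    (h : (univ k G).map f.toRingHom = (univ k G).map f'.toRingHom) : f = f' := by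
  refine Ideal.Quotient.algHom_ext _ (MvPolynomial.algHom_ext fun i => ?_)
  rcases i with g | g
  · exact congrFun (congrArg TraceDet.tr h) g
  · exact DFunLike.congr_fun (congrArg TraceDet.det h) g

variable (k G) in
theorem adjoin_univ :
    Algebra.adjoin k (Set.range (univ k G).tr ∪ Set.range (univ k G).det) = ⊤ := by
  have h := congrArg (Subalgebra.map (Ideal.Quotient.mkₐ k (Ideal.span (rels k G))))
    (MvPolynomial.adjoin_range_X (R := k) (σ := G ⊕ G))
  rw [AlgHom.map_adjoin, Algebra.map_top, AlgHom.range_eq_top _ |>.mpr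
    (Ideal.Quotient.mkₐ_surjective _ _)] at h
  rw [← h, ← Set.range_comp]
  congr 1
  ext x
  simp only [Set.mem_union, Set.mem_range, Sum.exists]
  rfl

end TraceDet

end

/-! ### Completeness of finite algebras; finiteness and locality of the classifying ring. -/

noncomputable section

open IsLocalRing

section Complete

/-- The completion of a finite module is a quotient of its tensor product with the completion of
`k`, and `k` already surjects onto the latter. -/
theorem IsPrecomplete.of_finite {k : Type*} [CommRing k] (I : Ideal k) [IsAdicComplete I k]
    (M : Type*) [AddCommGroup M] [Module k M] [Module.Finite k M] : IsPrecomplete I M := by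
  rw [← AdicCompletion.of_surjective_iff]
  intro x
  obtain ⟨t, rfl⟩ := AdicCompletion.ofTensorProduct_surjective_of_finite I M x
  induction t with
  | zero => exact ⟨0, by simp⟩
  | add x y hx hy =>
    obtain ⟨a, ha⟩ := hx
    obtain ⟨b, hb⟩ := hy
    exact ⟨a + b, by rw [map_add, map_add, ha, hb]⟩
  | tmul r m =>
    obtain ⟨r, rfl⟩ := AdicCompletion.of_surjective I k r
    refine ⟨r • m, ?_⟩
    rw [AdicCompletion.ofTensorProduct_tmul, map_smul]
    exact (algebraMap_smul (AdicCompletion I k) r (AdicCompletion.of I M m)).symm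

/-- If `f` is Cauchy for `J`, then `n ↦ f (N * n)` is Cauchy for `I`, and its limit serves for `f`.
-/
theorem IsPrecomplete.of_pow_le {C : Type*} [CommRing C] {I J : Ideal C} (hIJ : I ≤ J) {N : ℕ}
    (hN : J ^ N ≤ I) [hI : IsPrecomplete I C] : IsPrecomplete J C := by
  refine ⟨fun f hf => ?_⟩
  have hf' {m n : ℕ} (hmn : m ≤ n) : f (N * m) ≡ f (N * n) [SMOD (I ^ m • ⊤ : Ideal C)] := by
    have h := hf (Nat.mul_le_mul_left N hmn)
    rw [SModEq.sub_mem, smul_eq_mul, Ideal.mul_top] at h ⊢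
    rw [pow_mul] at h
    exact Ideal.pow_right_mono hN m h
  obtain ⟨L, hL⟩ := hI.prec hf'
  refine ⟨L, fun n => ?_⟩
  rcases Nat.eq_zero_or_pos N with rfl | hN0
  · have : J = ⊤ := by
      rw [pow_zero, Ideal.one_eq_top, top_le_iff] at hN
      exact top_le_iff.mp (hN ▸ hIJ)
    simp [this, SModEq.top, Ideal.top_pow]
  · have h1 := hf (Nat.le_mul_of_pos_left n hN0)
    refine h1.trans ?_
    have h2 := hL n
    rw [SModEq.sub_mem, smul_eq_mul, Ideal.mul_top] at h2 ⊢
    exact Ideal.pow_right_mono hIJ n h2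

/-- Finite local algebras over complete local Noetherian rings are complete. -/
theorem isAdicComplete_maximalIdeal_of_finite (k C : Type*) [CommRing k] [IsLocalRing k]
    [IsNoetherianRing k] [IsAdicComplete (maximalIdeal k) k] [CommRing C] [IsLocalRing C]
    [Algebra k C] [Module.Finite k C] : IsAdicComplete (maximalIdeal C) C := by
  have : IsNoetherianRing C := IsNoetherianRing.of_finite k C
  set I := (maximalIdeal k).map (algebraMap k C)
  have hI : IsPrecomplete I C := IsPrecomplete.map_algebraMap_iff.mpr (.of_finite _ _)
  have hle : I ≤ maximalIdeal C := by
    refine le_maximalIdeal fun h => ?_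
    have := Algebra.IsIntegral.of_finite k C
    have hm : ((maximalIdeal C).comap (algebraMap k C)).IsMaximal :=
      Ideal.isMaximal_comap_of_isIntegral_of_isMaximal _
    have : I ≤ maximalIdeal C := Ideal.map_le_iff_le_comap.mpr (eq_maximalIdeal hm).ge
    exact (Ideal.IsPrime.ne_top inferInstance) (top_le_iff.mp (h ▸ this))
  -- The fibre `C ⧸ I` is finite over the residue field, so Artinian; thus a power of the maximal
  -- ideal of `C` lies in `I`. Separatedness is Krull's intersection theorem.
  have : Module.Finite (k ⧸ maximalIdeal k) (C ⧸ I) := .of_restrictScalars_finite k _ _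
  have : IsArtinianRing (k ⧸ maximalIdeal k) := inferInstanceAs (IsArtinianRing (ResidueField k))
  have : IsArtinianRing (C ⧸ I) := .of_finite (k ⧸ maximalIdeal k) _
  obtain ⟨N, hN⟩ := exists_maximalIdeal_pow_le_of_isArtinianRing_quotient I
  have := IsPrecomplete.of_pow_le hle hN
  exact { }

end Complete

namespace TraceDet

variable {A : Type u} [CommRing A] {G : Type w} [Group G]

/-- This formula drives the inductions on the order of `g`, a power of two, because it passes from
`g ^ 2` to `g`. -/
theorem tr_mul_self (P : TraceDet A G) (g : G) : P.tr (g ^ 2) = P.tr g ^ 2 - 2 * P.det g := by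
  have := P.tr_mul_tr g g
  rw [inv_mul_cancel, tr_one] at this
  rw [pow_two g]
  linear_combination -this

section Integral

variable {k : Type*} [CommRing k] [Algebra k A]

theorem isIntegral_det [Finite G] (P : TraceDet A G) (g : G) : IsIntegral k (P.det g) := by
  refine IsIntegral.of_pow (Nat.card_pos (α := G)) ?_
  rw [← map_pow, pow_card_eq_one', map_one]
  exact isIntegral_one

theorem isIntegral_tr [Finite G] (hG : IsPGroup 2 G) (P : TraceDet A G) (g : G) :
    IsIntegral k (P.tr g) := by
  have key (n : ℕ) : ∀ g, g ^ 2 ^ n = 1 → IsIntegral k (P.tr g) := by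
    induction n with
    | zero =>
      intro g hg
      rw [pow_zero, pow_one] at hg
      rw [hg, P.tr_one]
      have := isIntegral_algebraMap (R := k) (A := A) (x := 2)
      rwa [map_ofNat] at this
    | succ n ih =>
      intro g hg
      refine IsIntegral.of_pow two_pos ?_
      have h2 : IsIntegral k (2 : A) := by
        have := isIntegral_algebraMap (R := k) (A := A) (x := 2)
        rwa [map_ofNat] at this
      have h3 := (ih (g ^ 2) (by rw [← pow_mul, ← pow_succ', hg])).add
        (h2.mul (P.isIntegral_det g))
      rwa [P.tr_mul_self, sub_add_cancel] at h3
  obtain ⟨n, hn⟩ := hG g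
  exact key n g hn

-- The generators are finitely many and integral: determinants are roots of unity, and `tr(g)² =
-- tr(g²) + 2 det(g)` handles traces. Hence no completion is needed to obtain the pseudodeformation
-- ring.
variable (k) in
theorem finite_universalRing {k : Type u} [CommRing k] [Finite G] (hG : IsPGroup 2 G) :
    Module.Finite k (UniversalRing k G) := by
  rw [Module.finite_def, ← Algebra.top_toSubmodule, ← adjoin_univ]
  refine Submodule.fg_top _ |>.mp ?_
  rw [← Module.finite_def]
  refine Algebra.finite_adjoin_of_finite_of_isIntegral
    ((Set.finite_range _).union (Set.finite_range _)) ?_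
  rintro x (⟨g, rfl⟩ | ⟨g, rfl⟩)
  · exact isIntegral_tr hG _ _
  · exact isIntegral_det _ _

end Integral

/-- Modulo two, trace and `det - 1` of `g²` are the squares of those of `g`, and a domain has no
nilpotents. So residually there is only one pair. -/
theorem det_eq_one_and_tr_eq_zero [IsDomain A] (h2 : (2 : A) = 0) (hG : IsPGroup 2 G)
    (P : TraceDet A G) (g : G) : P.det g = 1 ∧ P.tr g = 0 := by
  have key (n : ℕ) : ∀ g, g ^ 2 ^ n = 1 → P.det g = 1 ∧ P.tr g = 0 := by
    induction n with
    | zero =>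
      intro g hg
      rw [pow_zero, pow_one] at hg
      rw [hg, map_one, P.tr_one, h2]
      exact ⟨rfl, rfl⟩
    | succ n ih =>
      intro g hg
      obtain ⟨h3, h4⟩ := ih (g ^ 2) (by rw [← pow_mul, ← pow_succ', hg])
      rw [map_pow] at h3
      rw [P.tr_mul_self, h2, zero_mul, sub_zero] at h4
      refine ⟨sub_eq_zero.mp (eq_zero_of_pow_eq_zero (n := 2) ?_), eq_zero_of_pow_eq_zero h4⟩
      linear_combination h3 + (1 - P.det g) * h2
  obtain ⟨n, hn⟩ := hG g
  exact key n g hn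

theorem subsingleton_of_isDomain [IsDomain A] (h2 : (2 : A) = 0) (hG : IsPGroup 2 G) :
    Subsingleton (TraceDet A G) := by
  refine ⟨fun P Q => TraceDet.ext (funext fun g => ?_) (MonoidHom.ext fun g => ?_)⟩
  · rw [(P.det_eq_one_and_tr_eq_zero h2 hG g).2, (Q.det_eq_one_and_tr_eq_zero h2 hG g).2]
  · rw [(P.det_eq_one_and_tr_eq_zero h2 hG g).1, (Q.det_eq_one_and_tr_eq_zero h2 hG g).1]

/-- The universal ring of a finite 2-group over a local ring of residue characteristic two is
local. -/
theorem isLocalRing_universalRing {k : Type u} [CommRing k] [IsLocalRing k] [Finite G]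
    (h2 : (2 : k) ∈ maximalIdeal k) (hG : IsPGroup 2 G) [Nontrivial (UniversalRing k G)] :
    IsLocalRing (UniversalRing k G) := by
  have := finite_universalRing (k := k) hG
  have := Algebra.IsIntegral.of_finite k (UniversalRing k G)
  have hcomap (M : Ideal (UniversalRing k G)) (hM : M.IsMaximal) :
      M.comap (algebraMap k (UniversalRing k G)) = maximalIdeal k :=
    eq_maximalIdeal (Ideal.isMaximal_comap_of_isIntegral_of_isMaximal M)
  obtain ⟨M, hM⟩ := Ideal.exists_maximal (UniversalRing k G)
  refine .of_unique_max_ideal ⟨M, hM, fun M' hM' => (hM'.eq_of_le hM.ne_top ?_)⟩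
  have hP (M : Ideal (UniversalRing k G)) (hM : M.IsMaximal) (g : G) :
      (univ k G).det g - 1 ∈ M ∧ (univ k G).tr g ∈ M := by
    have h2' : (2 : UniversalRing k G ⧸ M) = 0 := by
      have : algebraMap k (UniversalRing k G) 2 ∈ M := by
        rw [← Ideal.mem_comap, hcomap M hM]
        exact h2
      rwa [map_ofNat, ← Ideal.Quotient.eq_zero_iff_mem, map_ofNat] at this
    have h3 := TraceDet.det_eq_one_and_tr_eq_zero (A := UniversalRing k G ⧸ M) h2' hG
      ((univ k G).map (Ideal.Quotient.mk M)) g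
    refine ⟨?_, Ideal.Quotient.eq_zero_iff_mem.mp h3.2⟩
    rw [← Ideal.Quotient.eq_zero_iff_mem, map_sub, map_one, sub_eq_zero]
    exact h3.1
  -- Each generator is congruent to the same constant, `0` or `1`, modulo every maximal ideal. So
  -- every element is constant modulo `M ⊓ M'`, and both ideals are determined by their common trace
  -- on `k`.
  have key (x : UniversalRing k G) : ∃ y : k, x - algebraMap k _ y ∈ M ⊓ M' := by
    have hx : x ∈ Algebra.adjoin k (Set.range (univ k G).tr ∪ Set.range (univ k G).det) := by
      rw [adjoin_univ]
      trivial
    induction hx using Algebra.adjoin_induction with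
    | mem x hx =>
      rcases hx with ⟨g, rfl⟩ | ⟨g, rfl⟩
      · exact ⟨0, by simpa using ⟨(hP M hM g).2, (hP M' hM' g).2⟩⟩
      · exact ⟨1, by simpa using ⟨(hP M hM g).1, (hP M' hM' g).1⟩⟩
    | algebraMap y => exact ⟨y, by simp⟩
    | add x x' _ _ hx hx' =>
      obtain ⟨y, hy⟩ := hx
      obtain ⟨y', hy'⟩ := hx'
      refine ⟨y + y', ?_⟩
      rw [map_add, add_sub_add_comm]
      exact add_mem hy hy'
    | mul x x' _ _ hx hx' =>
      obtain ⟨y, hy⟩ := hx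
      obtain ⟨y', hy'⟩ := hx'
      refine ⟨y * y', ?_⟩
      have : x * x' - algebraMap k (UniversalRing k G) (y * y') =
          x' * (x - algebraMap k _ y) + algebraMap k _ y * (x' - algebraMap k _ y') := by
        rw [map_mul]
        ring
      rw [this]
      exact add_mem (Ideal.mul_mem_left _ _ hy) (Ideal.mul_mem_left _ _ hy')
  intro x hx
  obtain ⟨y, hy⟩ := key x
  have hy' : algebraMap k (UniversalRing k G) y ∈ M' := by
    simpa using sub_mem hx hy.2
  rw [← Ideal.mem_comap, hcomap M' hM', ← hcomap M hM] at hy'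
  simpa using add_mem hy.1 hy'

end TraceDet

end

/-! ### The pseudodeformation ring of a finite 2-group. -/

noncomputable section

open IsLocalRing

namespace TraceDet

variable {G : Type} [Group G] [Finite G] (Dbar : GroupDet (ZMod 2) G 2)

/-- The reduction of the universal ring that is given by a residual determinant. -/
def universalRed : UniversalRing ℤ_[2] G →+* ZMod 2 :=
  letI : Algebra ℤ_[2] (ZMod 2) := PadicInt.toZMod.toAlgebra
  ((lift Dbar.toTraceDet : UniversalRing ℤ_[2] G →ₐ[ℤ_[2]] ZMod 2) :
    UniversalRing ℤ_[2] G →+* ZMod 2)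

theorem map_universalRed : (univ ℤ_[2] G).map (universalRed Dbar) = Dbar.toTraceDet :=
  letI : Algebra ℤ_[2] (ZMod 2) := PadicInt.toZMod.toAlgebra
  map_lift_univ _

theorem isLocalRing_universalRing_padicInt (hG : IsPGroup 2 G) :
    IsLocalRing (UniversalRing ℤ_[2] G) := by
  have : Nontrivial (UniversalRing ℤ_[2] G) :=
    (universalRed (GroupDet.ofRep (1 : G →* GL (Fin 2) (ZMod 2)))).domain_nontrivial
  refine isLocalRing_universalRing ?_ hG
  rw [PadicInt.maximalIdeal_eq_span_p]
  exact Ideal.subset_span rfl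

variable (hG : IsPGroup 2 G)

/-- The universal ring of a finite 2-group as a coefficient ring. -/
def universalCoeffRing : CoeffRing 2 :=
  haveI := isLocalRing_universalRing_padicInt hG
  .ofRingHom (UniversalRing ℤ_[2] G) (universalRed Dbar)

theorem isCompleteNoetherian_universalCoeffRing :
    (universalCoeffRing Dbar hG).IsCompleteNoetherian := by
  have := isLocalRing_universalRing_padicInt hG
  have := finite_universalRing (k := ℤ_[2]) hG
  exact ⟨IsNoetherianRing.of_finite ℤ_[2] (UniversalRing ℤ_[2] G),
    isAdicComplete_maximalIdeal_of_finite ℤ_[2] (UniversalRing ℤ_[2] G)⟩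

/-- The universal pair over the universal coefficient ring. -/
def univCoeff : TraceDet (universalCoeffRing Dbar hG) G := univ ℤ_[2] G

theorem map_red_univCoeff :
    (univCoeff Dbar hG).map (universalCoeffRing Dbar hG).red = Dbar.toTraceDet := by
  rw [← map_universalRed]
  exact congrArg (univCoeff Dbar hG).map (CoeffRing.ringHom_zmod_ext _ _)

/-- The pseudodeformation ring of a finite 2-group represents the functor of all determinants. -/
theorem isUniversalPseudodeformation_toGroupDet :
    IsUniversalPseudodeformation Dbar (universalCoeffRing Dbar hG)
      (univCoeff Dbar hG).toGroupDet where
  complete := isCompleteNoetherian_universalCoeffRing Dbar hG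
  reduces := by
    rw [GroupDet.specializesTo_iff, toTraceDet_toGroupDet, map_red_univCoeff]
  universal A _ E _ := by
    simp only [GroupDet.specializesTo_iff, toTraceDet_toGroupDet]
    let f : universalCoeffRing Dbar hG →ₐ[ℤ_[2]] A :=
      (lift E.toTraceDet : UniversalRing ℤ_[2] G →ₐ[ℤ_[2]] A)
    refine ⟨.ofAlgHom f, (map_lift_univ E.toTraceDet).symm, fun g hg => CoeffRing.Hom.ext ?_⟩
    exact algHom_ext (k := ℤ_[2]) (G := G) (f := g.toAlgHom) (f' := f)
      (hg.symm.trans (map_lift_univ E.toTraceDet).symm)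

end TraceDet

/-- The universal pseudodeformation ring of a finite 2-group is the universal ring of
trace-determinant pairs. -/
theorem IsUniversalPseudodeformation.exists_algEquiv {G : Type} [Group G] [Finite G]
    (hG : IsPGroup 2 G) {Dbar : GroupDet (ZMod 2) G 2} {R : CoeffRing 2} {D : GroupDet R G 2}
    (hR : IsUniversalPseudodeformation Dbar R D) :
    ∃ e : TraceDet.UniversalRing ℤ_[2] G ≃ₐ[ℤ_[2]] R,
      (TraceDet.univ ℤ_[2] G).map (e : TraceDet.UniversalRing ℤ_[2] G →+* R) = D.toTraceDet := by
  obtain ⟨ψ, hψ, -⟩ := hR.existsUnique_algHom_of_complete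
    (TraceDet.isCompleteNoetherian_universalCoeffRing Dbar hG)
    (TraceDet.univCoeff Dbar hG) (TraceDet.map_red_univCoeff Dbar hG)
  let ψ' : R →ₐ[ℤ_[2]] TraceDet.UniversalRing ℤ_[2] G := ψ
  let φ : TraceDet.UniversalRing ℤ_[2] G →ₐ[ℤ_[2]] R := TraceDet.lift D.toTraceDet
  have hφ : (TraceDet.univ ℤ_[2] G).map (φ : TraceDet.UniversalRing ℤ_[2] G →+* R) =
      D.toTraceDet := TraceDet.map_lift_univ _
  have hψ' : D.toTraceDet.map (ψ' : R →+* TraceDet.UniversalRing ℤ_[2] G) =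
      TraceDet.univ ℤ_[2] G := hψ
  have h1 : ψ'.comp φ = AlgHom.id _ _ := TraceDet.algHom_ext (by
    change ((TraceDet.univ ℤ_[2] G).map (φ : TraceDet.UniversalRing ℤ_[2] G →+* R)).map
      (ψ' : R →+* TraceDet.UniversalRing ℤ_[2] G) = TraceDet.univ ℤ_[2] G
    rw [hφ, hψ'])
  have h2 : φ.comp ψ' = AlgHom.id _ _ :=
    (hR.existsUnique_algHom_of_complete hR.complete D.toTraceDet hR.map_red).unique (by
      change (D.toTraceDet.map (ψ' : R →+* TraceDet.UniversalRing ℤ_[2] G)).map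
        (φ : TraceDet.UniversalRing ℤ_[2] G →+* R) = D.toTraceDet
      rw [hψ', hφ]) rfl
  exact ⟨AlgEquiv.ofAlgHom φ ψ' h2 h1, hφ⟩

end

/-! ### Completion of a Noetherian ring at a point over `𝔽_p`. -/

noncomputable section

namespace AdicCompletion

/-- Adic completions of Noetherian rings are Noetherian. -/
theorem isNoetherianRing {P : Type*} [CommRing P] [IsNoetherianRing P] (m : Ideal P) :
    IsNoetherianRing (AdicCompletion m P) := by
  obtain ⟨n, y, hy⟩ := Submodule.fg_iff_exists_fin_generating_family.mp
    (IsNoetherian.noetherian m)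
  change Ideal.span (Set.range y) = m at hy
  have hm : m.FG := IsNoetherian.noetherian m
  let I := MvPolynomial.idealOfVars (Fin n) P
  have hI : I.FG := MvPolynomial.idealOfVars_fg (Fin n) P
  -- Sending the variables to generators of `m` induces, after completion, a map from power series
  -- over `P` to the completion of `P`. It will be surjective, and power series over a Noetherian
  -- ring are Noetherian.
  let e : MvPolynomial (Fin n) P →+* P := (MvPolynomial.aeval y : _ →ₐ[P] P)
  have heI : I.map e = m := by
    rw [← hy, Ideal.map_span, ← Set.range_comp]
    congr 2
    ext i
    simp [e]
  have hle (k : ℕ) : I ^ k ≤ (m ^ k).comap e := by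
    rw [← Ideal.map_le_iff_le_comap, Ideal.map_pow, heI]
  let f (k : ℕ) : AdicCompletion I (MvPolynomial (Fin n) P) →+* P ⧸ m ^ k :=
    (Ideal.quotientMap (m ^ k) e (hle k)).comp (evalₐ I k : _ →+* _)
  have hf {j k : ℕ} (hjk : j ≤ k) : (Ideal.Quotient.factorPow m hjk).comp (f k) = f j := by
    ext x
    induction x using AdicCompletion.induction_on with
    | _ x =>
      simp only [f, RingHom.comp_apply, RingHom.coe_coe, evalₐ_mk, Ideal.quotientMap_mk]
      have h : Ideal.quotientMap (m ^ j) e (hle j) (Ideal.Quotient.mk (I ^ j) (x.val k)) =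
          Ideal.quotientMap (m ^ j) e (hle j) (Ideal.Quotient.mk (I ^ j) (x.val j)) :=
        congrArg _ (Ideal.mk_eq_mk I hjk x)
      rw [Ideal.quotientMap_mk, Ideal.quotientMap_mk] at h
      exact h
  let F : AdicCompletion I (MvPolynomial (Fin n) P) →+* AdicCompletion m P := liftRingHom m f hf
  have hFof (x : MvPolynomial (Fin n) P) : F (algebraMap _ _ x) = algebraMap _ _ (e x) := by
    refine ext_evalₐ fun k => ?_
    rw [evalₐ_liftRingHom, algebraMap_apply, algebraMap_apply, evalₐ_of]
    simp only [f, RingHom.comp_apply, RingHom.coe_coe]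
    rw [evalₐ_of, Ideal.quotientMap_mk]
    rfl
  let J := I.map (algebraMap (MvPolynomial (Fin n) P) (AdicCompletion I (MvPolynomial (Fin n) P)))
  have hJ : J.map F = m.map (algebraMap P (AdicCompletion m P)) := by
    have h : F.comp (algebraMap _ _) = (algebraMap P (AdicCompletion m P)).comp e :=
      RingHom.ext hFof
    rw [Ideal.map_map, h, ← Ideal.map_map, heI]
  have hc1 : IsAdicComplete J _ := isAdicComplete_self I hI
  have hc2 := isAdicComplete_self m hm
  -- By completeness, surjectivity need only be checked modulo the ideal of the variables, where
  -- constants suffice.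
  have hsurj : Function.Surjective F := by
    have : IsHausdorff (J.map F) (AdicCompletion m P) := by
      rw [hJ]
      infer_instance
    refine surjective_of_mk_map_comp_surjective (I := J) F fun x => ?_
    obtain ⟨x, rfl⟩ := Ideal.Quotient.mk_surjective x
    obtain ⟨y, hy⟩ := Ideal.Quotient.mk_surjective (evalOneₐ m x)
    refine ⟨algebraMap (MvPolynomial (Fin n) P) _ (MvPolynomial.C y), ?_⟩
    rw [RingHom.comp_apply, hFof, Ideal.Quotient.eq, hJ, ← ker_evalOneₐ_eq_map m hm]
    have heC : e (MvPolynomial.C y) = y := MvPolynomial.aeval_C _ _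
    rw [RingHom.mem_ker, map_sub, sub_eq_zero, heC, algebraMap_apply]
    exact hy
  have : IsNoetherianRing (AdicCompletion I (MvPolynomial (Fin n) P)) :=
    isNoetherianRing_of_ringEquiv _
      (MvPowerSeries.toAdicCompletionAlgEquiv (Fin n) P).toRingEquiv
  exact isNoetherianRing_of_surjective _ _ F hsurj

end AdicCompletion

end

noncomputable section

open IsLocalRing

namespace CoeffRing

variable {p : ℕ} [Fact p.Prime] {P : Type} [CommRing P] [IsNoetherianRing P] (ε : P →+* ZMod p)

/-- The completion of a Noetherian ring at an `𝔽_p`-point. -/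
abbrev Completion : Type := AdicCompletion (RingHom.ker ε) P

theorem isMaximal_map_ker :
    ((RingHom.ker ε).map (algebraMap P (Completion ε))).IsMaximal :=
  have := RingHom.ker_isMaximal_of_surjective ε (ZMod.ringHom_surjective ε)
  AdicCompletion.isMaximal_map_of_le _ _ le_rfl (IsNoetherian.noetherian _)

theorem isLocalRing_completion : IsLocalRing (Completion ε) :=
  have := isMaximal_map_ker ε
  have := AdicCompletion.isAdicComplete_self (RingHom.ker ε) (IsNoetherian.noetherian _)
  isLocalRing_of_isAdicComplete_maximal ((RingHom.ker ε).map (algebraMap P (Completion ε)))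

variable [Algebra ℤ_[p] P]

/-- The completion of a Noetherian `ℤ_p`-algebra at an `𝔽_p`-point, as a coefficient ring. -/
def completion : CoeffRing p :=
  haveI := isLocalRing_completion ε
  .ofRingHom (Completion ε) ((RingHom.kerLift ε).comp
    (AdicCompletion.evalOneₐ (RingHom.ker ε) : Completion ε →+* P ⧸ RingHom.ker ε))

theorem isCompleteNoetherian_completion : (completion ε).IsCompleteNoetherian := by
  have := isLocalRing_completion ε
  refine ⟨AdicCompletion.isNoetherianRing (RingHom.ker ε), ?_⟩
  have h : (RingHom.ker ε).map (algebraMap P (Completion ε)) = maximalIdeal (Completion ε) :=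
    eq_maximalIdeal (isMaximal_map_ker ε)
  change IsAdicComplete (maximalIdeal (Completion ε)) (Completion ε)
  rw [← h]
  exact AdicCompletion.isAdicComplete_self (RingHom.ker ε) (IsNoetherian.noetherian _)

/-- The homomorphism to the completion. -/
def toCompletion : P →ₐ[ℤ_[p]] completion ε :=
  IsScalarTower.toAlgHom ℤ_[p] P (Completion ε)

theorem red_comp_toCompletion :
    (completion ε).red.comp (toCompletion ε : P →+* completion ε) = ε := by
  rw [ringHom_zmod_ext (completion ε).red (show completion ε →+* ZMod p from
    (RingHom.kerLift ε).comp
      (AdicCompletion.evalOneₐ (RingHom.ker ε) : Completion ε →+* P ⧸ RingHom.ker ε))]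
  rfl

/-- The completion pro-represents homomorphisms that reduce to the given point. -/
theorem existsUnique_completion (A : CoeffRing p) [IsArtinianRing A] (f : P →ₐ[ℤ_[p]] A)
    (hf : A.red.comp (f : P →+* A) = ε) :
    ∃! F : completion ε →ₐ[ℤ_[p]] A, F.comp (toCompletion ε) = f := by
  obtain ⟨N, hN⟩ := (isArtinianRing_iff_isNilpotent_maximalIdeal A).mp inferInstance
  have hle : RingHom.ker ε ≤ (maximalIdeal A).comap f := by
    intro x hx
    rw [Ideal.mem_comap, ← ker_red, RingHom.mem_ker]
    rw [← hf] at hx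
    exact hx
  have hpow (x : P) (hx : x ∈ RingHom.ker ε ^ N) : f x = 0 := by
    have h1 : RingHom.ker ε ^ N ≤ (maximalIdeal A ^ N).comap f :=
      (Ideal.pow_right_mono hle N).trans (Ideal.le_comap_pow _ _)
    have h2 := h1 hx
    rwa [hN] at h2
  let F : Completion ε →ₐ[ℤ_[p]] A := (Ideal.Quotient.liftₐ (RingHom.ker ε ^ N) f hpow).comp
    ((AdicCompletion.evalₐ (RingHom.ker ε) N).restrictScalars ℤ_[p])
  have key (F F' : Completion ε →ₐ[ℤ_[p]] A)
      (hF : F.comp (IsScalarTower.toAlgHom ℤ_[p] P (Completion ε)) = f)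
      (hF' : F'.comp (IsScalarTower.toAlgHom ℤ_[p] P (Completion ε)) = f) : F = F' := by
    -- No continuity is assumed. Since the ideal is finitely generated, the kernel of the projection
    -- to level `N` is generated by the `N`-th power of the ideal, on which `f` vanishes.
    have h0 (F : Completion ε →ₐ[ℤ_[p]] A)
        (hF : F.comp (IsScalarTower.toAlgHom ℤ_[p] P (Completion ε)) = f) (x : Completion ε)
        (hx : x ∈ (AdicCompletion.eval (RingHom.ker ε) P N).ker) : F x = 0 := by
      rw [← AdicCompletion.pow_smul_top_eq_ker_eval (IsNoetherian.noetherian _)] at hx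
      refine Submodule.smul_induction_on hx (fun r hr t _ => ?_) fun x y hx hy => ?_
      · rw [Algebra.smul_def, map_mul]
        have : F (algebraMap P (Completion ε) r) = f r := DFunLike.congr_fun hF r
        rw [this, hpow r hr, zero_mul]
      · rw [map_add, hx, hy, add_zero]
    refine AlgHom.ext fun x => ?_
    obtain ⟨y, hy⟩ := Submodule.mkQ_surjective _ (AdicCompletion.eval (RingHom.ker ε) P N x)
    have hxy : x - algebraMap P (Completion ε) y ∈
        (AdicCompletion.eval (RingHom.ker ε) P N).ker := by
      rw [LinearMap.mem_ker, map_sub, sub_eq_zero, ← hy]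
      rfl
    have h1 := h0 F hF _ hxy
    have h2 := h0 F' hF' _ hxy
    rw [map_sub, sub_eq_zero] at h1 h2
    rw [h1, h2]
    exact DFunLike.congr_fun (hF.trans hF'.symm) y
  refine ⟨F, ?_, fun F' hF' => key F' F hF' ?_⟩
  all_goals
    refine AlgHom.ext fun x => ?_
    change Ideal.Quotient.liftₐ (RingHom.ker ε ^ N) f hpow
      (AdicCompletion.evalₐ (RingHom.ker ε) N (AdicCompletion.of (RingHom.ker ε) P x)) = f x
    rw [AdicCompletion.evalₐ_of]
    rfl

end CoeffRing

/-! ### Representations and the framed deformation ring -/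

namespace UniversalRep

variable (k : Type u) [CommRing k] (G : Type w) [Group G] (d : ℕ)

/-- The matrix of variables attached to a group element. -/
def mat (g : G) : Matrix (Fin d) (Fin d) (MvPolynomial (G × Fin d × Fin d) k) :=
  .of fun i j => .X (g, i, j)

/-- The relations that make the generic matrices a representation. -/
def rels : Set (MvPolynomial (G × Fin d × Fin d) k) :=
  {r | ∃ i j, r = mat k G d 1 i j - (1 : Matrix (Fin d) (Fin d) _) i j ∨
    ∃ g h, r = mat k G d (g * h) i j - (mat k G d g * mat k G d h) i j}

/-- The `k`-algebra that represents the functor of all representations of `G` of dimension `d`. -/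
abbrev Ring : Type max u w := MvPolynomial (G × Fin d × Fin d) k ⧸ Ideal.span (rels k G d)

/-- The universal representation. -/
def univ : G →* GL (Fin d) (Ring k G d) :=
  MonoidHom.toHomUnits
    { toFun g := (mat k G d g).map (Ideal.Quotient.mk _)
      map_one' := by
        rw [← map_one (Ideal.Quotient.mk (Ideal.span (rels k G d))).mapMatrix]
        ext i j
        exact Ideal.Quotient.eq.mpr (Ideal.subset_span ⟨i, j, .inl rfl⟩)
      map_mul' g h := by
        rw [← Matrix.map_mul]
        ext i j
        exact Ideal.Quotient.eq.mpr (Ideal.subset_span ⟨i, j, .inr ⟨g, h, rfl⟩⟩) }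

variable {k G d} {A : Type*} [CommRing A] [Algebra k A]

/-- The homomorphism that classifies a representation. -/
def lift (σ : G →* GL (Fin d) A) : Ring k G d →ₐ[k] A :=
  let φ : MvPolynomial (G × Fin d × Fin d) k →ₐ[k] A :=
    MvPolynomial.aeval fun x => (σ x.1 : Matrix (Fin d) (Fin d) A) x.2.1 x.2.2
  Ideal.Quotient.liftₐ _ φ fun a ha => by
    have hmat (g : G) : (φ : MvPolynomial (G × Fin d × Fin d) k →+* A).mapMatrix (mat k G d g) = σ g := by
      ext i j
      exact MvPolynomial.aeval_X _ _
    suffices h : Ideal.span (rels k G d) ≤ RingHom.ker (φ : MvPolynomial (G × Fin d × Fin d) k →+* A) from h ha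
    rw [Ideal.span_le]
    rintro r ⟨i, j, rfl | ⟨g, h, rfl⟩⟩
    · have : (φ : MvPolynomial (G × Fin d × Fin d) k →+* A).mapMatrix (mat k G d 1) i j =
          (φ : MvPolynomial (G × Fin d × Fin d) k →+* A).mapMatrix (1 : Matrix (Fin d) (Fin d) _) i j := by
        rw [hmat, map_one, map_one]
        rfl
      rw [SetLike.mem_coe, RingHom.mem_ker, map_sub, sub_eq_zero]
      exact this
    · have : (φ : MvPolynomial (G × Fin d × Fin d) k →+* A).mapMatrix (mat k G d (g * h)) i j =
          (φ : MvPolynomial (G × Fin d × Fin d) k →+* A).mapMatrix (mat k G d g * mat k G d h) i j := by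
        rw [map_mul, hmat, hmat, hmat, map_mul]
        rfl
      rw [SetLike.mem_coe, RingHom.mem_ker, map_sub, sub_eq_zero]
      exact this

theorem map_lift_univ (σ : G →* GL (Fin d) A) :
    (Matrix.GeneralLinearGroup.map (lift σ : Ring k G d →ₐ[k] A).toRingHom).comp (univ k G d) =
      σ := by
  ext g i j
  exact MvPolynomial.aeval_X _ _

theorem algHom_ext {f f' : Ring k G d →ₐ[k] A}
    (h : (Matrix.GeneralLinearGroup.map f.toRingHom).comp (univ k G d) =
      (Matrix.GeneralLinearGroup.map f'.toRingHom).comp (univ k G d)) : f = f' := by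
  refine Ideal.Quotient.algHom_ext _ (MvPolynomial.algHom_ext fun ⟨g, i, j⟩ => ?_)
  exact congrArg (fun M : GL (Fin d) A => (M : Matrix (Fin d) (Fin d) A) i j)
    (DFunLike.congr_fun h g)

end UniversalRep

/-- Framed deformation rings of finite groups exist. -/
theorem exists_isUniversalLifting {p : ℕ} [Fact p.Prime] {G : Type} [Group G] [Finite G] {d : ℕ}
    (ρbar : G →* GL (Fin d) (ZMod p)) :
    ∃ (S : CoeffRing p) (ρ : G →* GL (Fin d) S), IsUniversalLifting ρbar S ρ := by
  let _ : Algebra ℤ_[p] (ZMod p) := PadicInt.toZMod.toAlgebra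
  -- The ring of all representations is of finite type since `G` is finite, hence Noetherian. Unlike
  -- the ring of pairs it need not be finite over `ℤ_p`, so it is completed at the point `ρbar`.
  let P := UniversalRep.Ring ℤ_[p] G d
  let ε : P →+* ZMod p := (UniversalRep.lift ρbar : P →ₐ[ℤ_[p]] ZMod p).toRingHom
  let ι := (CoeffRing.toCompletion ε).toRingHom
  refine ⟨CoeffRing.completion ε, (Matrix.GeneralLinearGroup.map ι).comp
    (UniversalRep.univ ℤ_[p] G d), CoeffRing.isCompleteNoetherian_completion ε, ?_, ?_⟩
  · have h : (CoeffRing.completion ε).red.comp ι = ε := CoeffRing.red_comp_toCompletion ε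
    rw [← MonoidHom.comp_assoc, ← Matrix.GeneralLinearGroup.map_comp, h]
    exact UniversalRep.map_lift_univ ρbar
  · intro A hA σ hσ
    let f : P →ₐ[ℤ_[p]] A := UniversalRep.lift σ
    have hf : (Matrix.GeneralLinearGroup.map f.toRingHom).comp (UniversalRep.univ ℤ_[p] G d) = σ :=
      UniversalRep.map_lift_univ σ
    let g : P →ₐ[ℤ_[p]] ZMod p :=
      { A.red.comp (f : P →+* A) with
        commutes' r := DFunLike.congr_fun (CoeffRing.ringHom_zmod_ext
          ((A.red.comp (f : P →+* A)).comp (algebraMap ℤ_[p] P)) PadicInt.toZMod) r }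
    have hg : g = UniversalRep.lift ρbar := UniversalRep.algHom_ext <| by
      refine Eq.trans ?_ (UniversalRep.map_lift_univ ρbar).symm
      rw [← hσ, ← hf]
      rfl
    have hred : A.red.comp (f : P →+* A) = ε := congrArg AlgHom.toRingHom hg
    obtain ⟨F, hF, huniq⟩ := CoeffRing.existsUnique_completion ε A f hred
    refine ⟨.ofAlgHom F, ?_, fun F' hF' => CoeffRing.Hom.ext (huniq _ ?_)⟩
    · rw [← hf, ← hF]
      rfl
    · refine UniversalRep.algHom_ext ?_
      rw [hf, ← hF']
      rfl

end

noncomputable section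

/-! ### Central extensions of elementary abelian 2-groups -/

/-- The central extension of `V` by `ℤ/2` with the bilinear cocycle `φ`. -/
@[ext]
structure CentralExt {V : Type*} [AddCommGroup V] (φ : V →+ V →+ ZMod 2) where
  center : ZMod 2
  quot : V

namespace CentralExt

variable {V : Type*} [AddCommGroup V] {φ : V →+ V →+ ZMod 2}

instance : Mul (CentralExt φ) :=
  ⟨fun x y => ⟨x.center + y.center + φ x.quot y.quot, x.quot + y.quot⟩⟩

instance : One (CentralExt φ) := ⟨⟨0, 0⟩⟩

instance : Inv (CentralExt φ) := ⟨fun x => ⟨x.center + φ x.quot x.quot, -x.quot⟩⟩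

@[simp] theorem center_mul (x y : CentralExt φ) :
    (x * y).center = x.center + y.center + φ x.quot y.quot := rfl
@[simp] theorem quot_mul (x y : CentralExt φ) : (x * y).quot = x.quot + y.quot := rfl
@[simp] theorem center_one : (1 : CentralExt φ).center = 0 := rfl
@[simp] theorem quot_one : (1 : CentralExt φ).quot = 0 := rfl
@[simp] theorem center_inv (x : CentralExt φ) :
    x⁻¹.center = x.center + φ x.quot x.quot := rfl
@[simp] theorem quot_inv (x : CentralExt φ) : x⁻¹.quot = -x.quot := rfl

instance : Group (CentralExt φ) :=
  .ofLeftAxioms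
    (fun x y z => by
      ext
      · simp only [center_mul, quot_mul, map_add, AddMonoidHom.add_apply]
        ring
      · simp [add_assoc])
    (fun x => by ext <;> simp)
    (fun x => by
      ext
      · simp [CharTwo.add_self_eq_zero, CharTwo.neg_eq, add_right_comm]
      · simp)

/-- The underlying set of a central extension. -/
def equivProd : CentralExt φ ≃ ZMod 2 × V where
  toFun x := (x.center, x.quot)
  invFun x := ⟨x.1, x.2⟩

end CentralExt

/-- The graded algebra `𝔽₂ ⊕ 𝔽₂^V ⊕ 𝔽₂` in which the product of two elements of degree one is their
standard scalar product. -/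
@[ext]
structure QuadricAlgebra (V : Type*) where
  deg0 : ZMod 2
  deg1 : V → ZMod 2
  deg2 : ZMod 2

namespace QuadricAlgebra

variable {V : Type*}

instance : Zero (QuadricAlgebra V) := ⟨⟨0, 0, 0⟩⟩
instance : One (QuadricAlgebra V) := ⟨⟨1, 0, 0⟩⟩
instance : Add (QuadricAlgebra V) := ⟨fun x y => ⟨x.deg0 + y.deg0, x.deg1 + y.deg1, x.deg2 + y.deg2⟩⟩
instance : Neg (QuadricAlgebra V) := ⟨fun x => ⟨-x.deg0, -x.deg1, -x.deg2⟩⟩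
@[simp] theorem deg0_zero : (0 : QuadricAlgebra V).deg0 = 0 := rfl
@[simp] theorem deg1_zero : (0 : QuadricAlgebra V).deg1 = 0 := rfl
@[simp] theorem deg2_zero : (0 : QuadricAlgebra V).deg2 = 0 := rfl
@[simp] theorem deg0_one : (1 : QuadricAlgebra V).deg0 = 1 := rfl
@[simp] theorem deg1_one : (1 : QuadricAlgebra V).deg1 = 0 := rfl
@[simp] theorem deg2_one : (1 : QuadricAlgebra V).deg2 = 0 := rfl
@[simp] theorem deg0_add (x y : QuadricAlgebra V) : (x + y).deg0 = x.deg0 + y.deg0 := rfl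
@[simp] theorem deg1_add (x y : QuadricAlgebra V) : (x + y).deg1 = x.deg1 + y.deg1 := rfl
@[simp] theorem deg2_add (x y : QuadricAlgebra V) : (x + y).deg2 = x.deg2 + y.deg2 := rfl
@[simp] theorem deg0_neg (x : QuadricAlgebra V) : (-x).deg0 = -x.deg0 := rfl
@[simp] theorem deg1_neg (x : QuadricAlgebra V) : (-x).deg1 = -x.deg1 := rfl
@[simp] theorem deg2_neg (x : QuadricAlgebra V) : (-x).deg2 = -x.deg2 := rfl

variable [Fintype V]

instance : Mul (QuadricAlgebra V) :=
  ⟨fun x y => ⟨x.deg0 * y.deg0, x.deg0 • y.deg1 + y.deg0 • x.deg1,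
    x.deg0 * y.deg2 + y.deg0 * x.deg2 + x.deg1 ⬝ᵥ y.deg1⟩⟩

@[simp] theorem deg0_mul (x y : QuadricAlgebra V) : (x * y).deg0 = x.deg0 * y.deg0 := rfl
@[simp] theorem deg1_mul (x y : QuadricAlgebra V) :
    (x * y).deg1 = x.deg0 • y.deg1 + y.deg0 • x.deg1 := rfl
@[simp] theorem deg2_mul (x y : QuadricAlgebra V) :
    (x * y).deg2 = x.deg0 * y.deg2 + y.deg0 * x.deg2 + x.deg1 ⬝ᵥ y.deg1 := rfl

instance : CommRing (QuadricAlgebra V) where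
  add_assoc x y z := by ext <;> simp [add_assoc]
  zero_add x := by ext <;> simp
  add_zero x := by ext <;> simp
  add_comm x y := by ext <;> simp [add_comm]
  neg_add_cancel x := by ext <;> simp [CharTwo.add_self_eq_zero]
  mul_assoc x y z := by
    ext
    · simp [mul_assoc]
    · simp; ring
    · simp; ring
  one_mul x := by ext <;> simp
  mul_one x := by ext <;> simp
  mul_comm x y := by
    ext
    · simp [mul_comm]
    · simp [add_comm]
    · simp [add_comm, dotProduct_comm]
  left_distrib x y z := by
    ext
    · simp; ring
    · simp; ring
    · simp; ring
  right_distrib x y z := by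
    ext
    · simp; ring
    · simp; ring
    · simp; ring
  zero_mul x := by ext <;> simp
  mul_zero x := by ext <;> simp
  nsmul := nsmulRec
  zsmul := zsmulRec

theorem two_eq_zero : (2 : QuadricAlgebra V) = 0 := by
  rw [← one_add_one_eq_two]
  ext <;> simp [CharTwo.add_self_eq_zero]

/-- The augmentation. -/
def toZMod : QuadricAlgebra V →+* ZMod 2 where
  toFun := deg0
  map_one' := rfl
  map_mul' _ _ := rfl
  map_zero' := rfl
  map_add' _ _ := rfl

theorem pow_three_of_deg0_eq_zero {x : QuadricAlgebra V} (hx : x.deg0 = 0) : x ^ 3 = 0 := by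
  rw [pow_succ, pow_two]
  ext <;> simp [hx]

instance : Finite (QuadricAlgebra V) :=
  Finite.of_injective (fun x => (x.deg0, x.deg1, x.deg2)) fun x y h => by
    simp only [Prod.mk.injEq] at h
    exact QuadricAlgebra.ext h.1 h.2.1 h.2.2

instance : Nontrivial (QuadricAlgebra V) := toZMod.domain_nontrivial

instance : IsLocalRing (QuadricAlgebra V) := by
  refine .of_isUnit_or_isUnit_one_sub_self fun x => ?_
  have h01 : ∀ t : ZMod 2, t = 0 ∨ t = 1 := by decide
  rcases h01 x.deg0 with h | h
  · exact .inr (IsNilpotent.isUnit_one_sub ⟨3, pow_three_of_deg0_eq_zero h⟩)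
  · refine .inl ?_
    have := IsNilpotent.isUnit_one_sub (r := 1 - x)
      ⟨3, pow_three_of_deg0_eq_zero (by simp [sub_eq_add_neg, h, CharTwo.add_self_eq_zero])⟩
    rwa [sub_sub_cancel] at this

instance : CharP (QuadricAlgebra V) 2 :=
  CharTwo.of_one_ne_zero_of_two_eq_zero one_ne_zero two_eq_zero

instance : Algebra ℤ_[2] (QuadricAlgebra V) :=
  ((ZMod.castHom (dvd_refl 2) (QuadricAlgebra V)).comp PadicInt.toZMod).toAlgebra

/-- The quadric algebra as a coefficient ring. -/
def coeffRing (V : Type) [Fintype V] : CoeffRing 2 := .ofRingHom (QuadricAlgebra V) toZMod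

end QuadricAlgebra

/-- A determinant of a central extension of an elementary abelian 2-group: elements `g` whose image
`v` in `V` is nonzero have trace `g² x_v`. -/
def CentralExt.traceDet {V : Type*} [AddCommGroup V] [Fintype V] [DecidableEq V]
    (φ : V →+ V →+ ZMod 2) (hV : ∀ v : V, v + v = 0) :
    TraceDet (QuadricAlgebra V) (CentralExt φ) where
  -- `φ v v` is the central coordinate of the square of an element over `v`. It vanishes for `v =
  -- 0`, where the trace is the central coordinate placed in degree two.
  tr x := ⟨0, Pi.single x.quot (φ x.quot x.quot), if x.quot = 0 then x.center else 0⟩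
  det := 1
  tr_one := by
    rw [QuadricAlgebra.two_eq_zero]
    ext <;> simp
  tr_mul_comm x y := by
    ext
    · rfl
    · simp [add_comm]
    · by_cases h : x.quot + y.quot = 0
      · have : x.quot = y.quot := by
          rw [eq_neg_of_add_eq_zero_left h, neg_eq_of_add_eq_zero_left (hV _)]
        simp [this, hV, add_comm]
      · simp [h, add_comm y.quot]
  tr_mul_tr x y := by
    have hneg (v : V) : -v = v := neg_eq_of_add_eq_zero_left (hV v)
    ext
    · simp
    · simp [hneg, CharTwo.add_self_eq_zero]
    -- Since `gh` and `g⁻¹h` lie over the same vector, the degree one parts have cancelled. In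
    -- degree two the product is nonzero only over equal vectors, where the identity becomes `q² =
    -- 3q` in `𝔽₂`.
    · by_cases h : x.quot = y.quot
      · have h01 : ∀ e e' q : ZMod 2, q * q = e + e' + q + (e + q + e' + q) := by decide
        simpa [hneg, h, hV] using h01 _ _ _
      · have h' : x.quot + y.quot ≠ 0 := fun h0 => h (by
          rw [eq_neg_of_add_eq_zero_left h0, hneg])
        simp [hneg, h, h']

end

/-! ### Normal forms and the order of the extraspecial group. -/

noncomputable section

namespace ExtraspecialGroup

/-- The bilinear form whose associated quadratic form is the square map of the extraspecial group. -/
def cocycle : (Fin 4 → ZMod 2) →+ (Fin 4 → ZMod 2) →+ ZMod 2 :=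
  AddMonoidHom.mk' (fun v => AddMonoidHom.mk'
    -- Multiplying words `a^i b^j c^k d^l`, a factor `a²` arises from `a · a`, from moving `b` past
    -- `a`, from `c · c`, and from moving `d` past `c`; these are the four terms.
    (fun w => v 0 * w 0 + v 1 * w 0 + v 2 * w 2 + v 3 * w 2)
    fun w w' => by simp only [Pi.add_apply]; ring)
    fun v v' => by ext w; simp; ring

theorem cocycle_apply (v w : Fin 4 → ZMod 2) :
    cocycle v w = v 0 * w 0 + v 1 * w 0 + v 2 * w 2 + v 3 * w 2 := rfl

/-- The images of the generators in the concrete extraspecial group. -/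
def genImage : ExtraGen → CentralExt cocycle
  | .a => ⟨0, ![1, 0, 0, 0]⟩
  | .b => ⟨0, ![0, 1, 0, 0]⟩
  | .c => ⟨0, ![0, 0, 1, 0]⟩
  | .d => ⟨0, ![0, 0, 0, 1]⟩

theorem lift_genImage : ∀ r ∈ extraRels, FreeGroup.lift genImage r = 1 := by
  have h2 : (1 : ZMod 2) + 1 = 0 := by decide
  rintro r (rfl | rfl | rfl | rfl | rfl | rfl | rfl | rfl | rfl | rfl)
  all_goals
    simp only [map_mul, map_inv, FreeGroup.lift_apply_of, genImage, pow_succ, pow_zero,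
      one_mul]
    ext i
    · simp [cocycle_apply, h2]
    · fin_cases i <;> simp [h2]

/-- The homomorphism to the concrete extraspecial group. -/
def toCentralExt : ExtraspecialGroup →* CentralExt cocycle :=
  PresentedGroup.toGroup lift_genImage

theorem toCentralExt_of (x : ExtraGen) : toCentralExt (PresentedGroup.of x) = genImage x :=
  PresentedGroup.toGroup.of _

/-- The power `g ^ e` with exponent `e = 0` or `e = 1`. -/
def bitPow {H : Type*} [Group H] (g : H) (e : ZMod 2) : H := if e = 0 then 1 else g

section

variable {H : Type*} [Group H]

theorem eq_zero_or_eq_one : ∀ e : ZMod 2, e = 0 ∨ e = 1 := by decide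

@[simp] theorem bitPow_zero (g : H) : bitPow g 0 = 1 := if_pos rfl

@[simp] theorem bitPow_one (g : H) : bitPow g 1 = g := if_neg (by decide)

@[simp] theorem bitPow_one_add_one (g : H) : bitPow g (1 + 1) = 1 := if_pos (by decide)

@[simp] theorem one_bitPow (e : ZMod 2) : bitPow (1 : H) e = 1 := ite_self _

theorem commute_bitPow {g h : H} (hgh : Commute g h) (e : ZMod 2) : Commute g (bitPow h e) := by
  rcases eq_zero_or_eq_one e with rfl | rfl <;> simp [hgh]

theorem bitPow_add {g : H} (hg : g * g = 1) (e e' : ZMod 2) :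
    bitPow g (e + e') = bitPow g e * bitPow g e' := by
  rcases eq_zero_or_eq_one e with rfl | rfl <;> rcases eq_zero_or_eq_one e' with rfl | rfl <;>
    simp [hg]

theorem mul_bitPow {g z : H} (hg : g * g = z) (e : ZMod 2) :
    g * bitPow g e = bitPow z e * bitPow g (1 + e) := by
  rcases eq_zero_or_eq_one e with rfl | rfl <;> simp [hg]

theorem mul_bitPow_of_comm {g h z : H} (hgh : g * h = z * h * g) (e : ZMod 2) :
    g * bitPow h e = bitPow z e * bitPow h e * g := by
  rcases eq_zero_or_eq_one e with rfl | rfl <;> simp [hgh]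

theorem map_bitPow {H' : Type*} [Group H'] (f : H →* H') (g : H) (e : ZMod 2) :
    f (bitPow g e) = bitPow (f g) e := by
  rcases eq_zero_or_eq_one e with rfl | rfl <;> simp

/-- The normal form of the elements of the extraspecial group. -/
def normalForm (f : ExtraGen → H) (x : CentralExt cocycle) : H :=
  bitPow (f .a ^ 2) x.center * (bitPow (f .a) (x.quot 0) * (bitPow (f .b) (x.quot 1) *
    (bitPow (f .c) (x.quot 2) * bitPow (f .d) (x.quot 3))))

/-- The new generator is moved right to its place in the word, and the central factors `a²` created
on the way are collected in front. Only the relations are used, so this holds for their solutions in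
any group. -/
theorem mul_normalForm {f : ExtraGen → H} (hf : ∀ r ∈ extraRels, FreeGroup.lift f r = 1)
    (t : ExtraGen) (x : CentralExt cocycle) :
    f t * normalForm f x = normalForm f (genImage t * x) := by
  have h1 := hf _ (.inl rfl)
  have h2 := hf _ (.inr (.inl rfl))
  have h3 := hf _ (.inr (.inr (.inl rfl)))
  have h4 := hf _ (.inr (.inr (.inr (.inl rfl))))
  have h5 := hf _ (.inr (.inr (.inr (.inr (.inl rfl)))))
  have h6 := hf _ (.inr (.inr (.inr (.inr (.inr (.inl rfl))))))
  have h7 := hf _ (.inr (.inr (.inr (.inr (.inr (.inr (.inl rfl)))))))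
  have h8 := hf _ (.inr (.inr (.inr (.inr (.inr (.inr (.inr (.inl rfl))))))))
  have h9 := hf _ (.inr (.inr (.inr (.inr (.inr (.inr (.inr (.inr (.inl rfl)))))))))
  have h10 := hf _ (.inr (.inr (.inr (.inr (.inr (.inr (.inr (.inr (.inr rfl)))))))))
  simp only [map_mul, map_pow, map_inv, FreeGroup.lift_apply_of, mul_inv_eq_one, inv_inv]
    at h1 h2 h3 h4 h5 h6 h7 h8 h9 h10
  obtain ⟨e, v⟩ := x
  generalize hA : f .a = A at *
  generalize hB : f .b = B at *
  generalize hC : f .c = C at *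
  generalize hD : f .d = D at *
  have hz : A ^ 2 * A ^ 2 = 1 := by rw [← pow_add, h1]
  have hA3 : A ^ 2 * A = A⁻¹ := by
    rw [eq_inv_iff_mul_eq_one, ← pow_succ, ← pow_succ, h1]
  rw [pow_two] at h2 h3
  have h4' : C * C = A ^ 2 := by rw [← pow_two, h4]
  have hBA : B * A = A ^ 2 * A * B := by
    rw [hA3, ← eq_inv_of_mul_eq_one_left h5, mul_assoc, h2, mul_one]
  have hDC : D * C = A ^ 2 * C * D := by
    rw [← h10, mul_assoc, h3, mul_one]
  have hAz : Commute A (A ^ 2) := (Commute.refl A).pow_right 2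
  have hCz : Commute C (A ^ 2) := Commute.pow_right h6.symm 2
  have hDz : Commute D (A ^ 2) := Commute.pow_right h7.symm 2
  have hBz : Commute B (A ^ 2) := by
    have h : (A ^ 2)⁻¹ = A ^ 2 := inv_eq_of_mul_eq_one_left hz
    rw [hA3] at hBA
    rw [Commute, SemiconjBy, pow_two, ← mul_assoc, hBA, mul_assoc, hBA, ← mul_assoc, ← mul_inv_rev,
      ← pow_two, h]
  have hZ (e k : ZMod 2) := bitPow_add hz e k
  have hc {X : H} (hX : Commute X (A ^ 2)) (j k : ZMod 2) :
      Commute (bitPow X j) (bitPow (A ^ 2) k) :=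
    (commute_bitPow (commute_bitPow hX k).symm j).symm
  cases t
  · have h := mul_bitPow (pow_two A).symm (v 0)
    have hx : genImage .a * ⟨e, v⟩ = ⟨e + v 0, ![1 + v 0, v 1, v 2, v 3]⟩ := by
      ext i
      · simp [genImage, cocycle_apply]
      · fin_cases i <;> simp [genImage]
    rw [hx]
    simp only [normalForm, hA, hB, hC, hD]
    change _ = bitPow (A ^ 2) (e + v 0) * (bitPow A (1 + v 0) * (bitPow B (v 1) *
      (bitPow C (v 2) * bitPow D (v 3))))
    rw [← mul_assoc A, (commute_bitPow hAz e).eq, mul_assoc, ← mul_assoc A, h, hZ]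
    simp only [mul_assoc]
  · have h := mul_bitPow_of_comm hBA (v 0)
    have h' := mul_bitPow h2 (v 1)
    have hx : genImage .b * ⟨e, v⟩ = ⟨e + v 0, ![v 0, 1 + v 1, v 2, v 3]⟩ := by
      ext i
      · simp [genImage, cocycle_apply]
      · fin_cases i <;> simp [genImage]
    rw [hx]
    simp only [normalForm, hA, hB, hC, hD]
    change _ = bitPow (A ^ 2) (e + v 0) * (bitPow A (v 0) * (bitPow B (1 + v 1) *
      (bitPow C (v 2) * bitPow D (v 3))))
    rw [(commute_bitPow hBz e).left_comm, ← mul_assoc B, h, mul_assoc, mul_assoc, ← mul_assoc B, h',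
      one_bitPow, one_mul, hZ, mul_assoc]
  · have hx : genImage .c * ⟨e, v⟩ = ⟨e + v 2, ![v 0, v 1, 1 + v 2, v 3]⟩ := by
      ext i
      · simp [genImage, cocycle_apply]
      · fin_cases i <;> simp [genImage]
    rw [hx]
    simp only [normalForm, hA, hB, hC, hD]
    change _ = bitPow (A ^ 2) (e + v 2) * (bitPow A (v 0) * (bitPow B (v 1) *
      (bitPow C (1 + v 2) * bitPow D (v 3))))
    have h := mul_bitPow h4' (v 2)
    rw [(commute_bitPow hCz e).left_comm, (commute_bitPow h6.symm (v 0)).left_comm,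
      (commute_bitPow h8.symm (v 1)).left_comm, ← mul_assoc C, h, mul_assoc,
      (hc hBz _ _).left_comm, (hc hAz _ _).left_comm, hZ, mul_assoc]
  · have hx : genImage .d * ⟨e, v⟩ = ⟨e + v 2, ![v 0, v 1, v 2, 1 + v 3]⟩ := by
      ext i
      · simp [genImage, cocycle_apply]
      · fin_cases i <;> simp [genImage]
    rw [hx]
    simp only [normalForm, hA, hB, hC, hD]
    change _ = bitPow (A ^ 2) (e + v 2) * (bitPow A (v 0) * (bitPow B (v 1) *
      (bitPow C (v 2) * bitPow D (1 + v 3))))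
    have h := mul_bitPow_of_comm hDC (v 2)
    have h' := mul_bitPow h3 (v 3)
    rw [(commute_bitPow hDz e).left_comm, (commute_bitPow h7.symm (v 0)).left_comm,
      (commute_bitPow h9.symm (v 1)).left_comm, ← mul_assoc D, h, mul_assoc, mul_assoc, h',
      one_bitPow, one_mul, (hc hBz _ _).left_comm, (hc hAz _ _).left_comm, hZ, mul_assoc]

theorem lift_of : FreeGroup.lift PresentedGroup.of = PresentedGroup.mk extraRels := by
  ext t
  exact FreeGroup.lift_apply_of

/-- The normal form `s` intertwines left multiplication by `g` with that by its image: on generators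
this is `mul_normalForm`, and it extends to all `g`. At the identity it says that `g` is recovered
from its image. -/
theorem toCentralExt_injective : Function.Injective toCentralExt := by
  let s : CentralExt cocycle → ExtraspecialGroup := normalForm PresentedGroup.of
  have hs (g : ExtraspecialGroup) : ∀ x, g * s x = s (toCentralExt g * x) := by
    have hg : g ∈ Subgroup.closure (Set.range (PresentedGroup.of (rels := extraRels))) := by
      rw [PresentedGroup.closure_range_of]
      trivial
    induction hg using Subgroup.closure_induction with
    | mem g hg =>
      obtain ⟨t, rfl⟩ := hg
      intro x
      rw [toCentralExt_of]
      refine mul_normalForm (fun r hr => ?_) t x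
      rw [lift_of]
      exact PresentedGroup.one_of_mem hr
    | one => simp
    | mul g h _ _ hg hh => intro x; rw [mul_assoc, hh, hg, map_mul, mul_assoc]
    | inv g _ hg => intro x; rw [inv_mul_eq_iff_eq_mul, hg, map_inv, mul_inv_cancel_left]
  have h1 : s 1 = 1 := by simp [s, normalForm]
  intro g h hgh
  have hg := hs g 1
  have hh := hs h 1
  rw [h1, mul_one] at hg hh
  rw [hg, hh, hgh]

theorem toCentralExt_surjective : Function.Surjective toCentralExt := by
  intro x
  refine ⟨normalForm PresentedGroup.of x, ?_⟩
  have h2 : (1 : ZMod 2) + 1 = 0 := by decide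
  obtain ⟨e, v⟩ := x
  simp only [normalForm, map_mul, map_bitPow, toCentralExt_of, genImage, pow_two]
  ext i
  · rcases eq_zero_or_eq_one e with rfl | rfl <;>
    rcases eq_zero_or_eq_one (v 0) with h0 | h0 <;>
    rcases eq_zero_or_eq_one (v 1) with h1 | h1 <;>
    rcases eq_zero_or_eq_one (v 2) with h3 | h3 <;>
    rcases eq_zero_or_eq_one (v 3) with h4 | h4 <;>
    simp [h0, h1, h3, h4, cocycle_apply, h2]
  · rcases eq_zero_or_eq_one e with rfl | rfl <;>
    rcases eq_zero_or_eq_one (v 0) with h0 | h0 <;>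
    rcases eq_zero_or_eq_one (v 1) with h1 | h1 <;>
    rcases eq_zero_or_eq_one (v 2) with h3 | h3 <;>
    rcases eq_zero_or_eq_one (v 3) with h4 | h4 <;>
    fin_cases i <;> simp [h0, h1, h3, h4, h2]

theorem card : Nat.card ExtraspecialGroup = 32 := by
  rw [Nat.card_congr ((Equiv.ofBijective _ ⟨toCentralExt_injective,
    toCentralExt_surjective⟩).trans CentralExt.equivProd), Nat.card_prod, Nat.card_fun]
  simp

instance : Finite ExtraspecialGroup := Nat.finite_of_card_ne_zero (by rw [card]; decide)

theorem isPGroup : IsPGroup 2 ExtraspecialGroup := .of_card (n := 5) card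

end

end ExtraspecialGroup

end

/-! ### Commutators of matrices of size two. -/

noncomputable section

namespace Matrix

variable {A : Type*} [CommRing A]

/-- The commutator of two matrices annihilates the non-scalar parts of the matrices commuting with
both; in particular, products of entries of two mutually centralizing commutators vanish. -/
theorem commutator_apply_mul_commutator_apply {X Y Z W : Matrix (Fin 2) (Fin 2) A}
    (hXZ : X * Z = Z * X) (hYZ : Y * Z = Z * Y) (i j k l : Fin 2) :
    (X * Y - Y * X) i j * (Z * W - W * Z) k l = 0 := by
  have e1 := congrFun₂ hXZ 0 0
  have e2 := congrFun₂ hXZ 0 1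
  have e3 := congrFun₂ hXZ 1 0
  have e4 := congrFun₂ hYZ 0 0
  have e5 := congrFun₂ hYZ 0 1
  have e6 := congrFun₂ hYZ 1 0
  simp only [mul_apply, Fin.sum_univ_two] at e1 e2 e3 e4 e5 e6
  -- The entries of `ZW - WZ` are linear combinations of the three coordinates `Z 0 1`, `Z 1 0`, `Z
  -- 0 0 - Z 1 1` of `Z` modulo scalars.
  have key (m1 : Z 0 1 * (X * Y - Y * X) i j = 0) (m2 : Z 1 0 * (X * Y - Y * X) i j = 0)
      (m3 : (Z 0 0 - Z 1 1) * (X * Y - Y * X) i j = 0) :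
      (X * Y - Y * X) i j * (Z * W - W * Z) k l = 0 := by
    generalize (X * Y - Y * X) i j = m at *
    fin_cases k <;> fin_cases l <;> simp only [sub_apply, mul_apply, Fin.sum_univ_two] <;> simp
    · linear_combination W 1 0 * m1 - W 0 1 * m2
    · linear_combination (W 1 1 - W 0 0) * m1 + W 0 1 * m3
    · linear_combination (W 0 0 - W 1 1) * m2 - W 1 0 * m3
    · linear_combination W 0 1 * m2 - W 1 0 * m1
  -- Commuting with `Z` means that the minors `x_i z_k - x_k z_i` and `y_i z_k - y_k z_i` of the
  -- coordinate vectors vanish. The entries of `XY - YX` are, up to sign, minors of `x` and `y`, and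
  -- `z_k (x_i y_j - x_j y_i) = x_k (z_i y_j - z_j y_i) = 0`.
  have a1 : X 0 1 * Z 1 0 = X 1 0 * Z 0 1 := by linear_combination e1
  have a2 : X 0 1 * (Z 0 0 - Z 1 1) = (X 0 0 - X 1 1) * Z 0 1 := by linear_combination -e2
  have a3 : X 1 0 * (Z 0 0 - Z 1 1) = (X 0 0 - X 1 1) * Z 1 0 := by linear_combination e3
  have b1 : Y 0 1 * Z 1 0 = Y 1 0 * Z 0 1 := by linear_combination e4
  have b2 : Y 0 1 * (Z 0 0 - Z 1 1) = (Y 0 0 - Y 1 1) * Z 0 1 := by linear_combination -e5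
  have b3 : Y 1 0 * (Z 0 0 - Z 1 1) = (Y 0 0 - Y 1 1) * Z 1 0 := by linear_combination e6
  apply key <;> fin_cases i <;> fin_cases j <;>
    simp only [sub_apply, mul_apply, Fin.sum_univ_two, Fin.zero_eta, Fin.mk_one]
  · linear_combination Y 0 1 * a1 - X 0 1 * b1
  · linear_combination -(Y 0 1 * a2 - X 0 1 * b2)
  · linear_combination Y 1 0 * a2 - (Y 0 0 - Y 1 1) * a1 - X 0 1 * b3
  · linear_combination -(Y 0 1 * a1 - X 0 1 * b1)
  · linear_combination Y 1 0 * a1 - X 1 0 * b1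
  · linear_combination -(Y 1 0 * a2 - (X 0 0 - X 1 1) * b1 - X 0 1 * b3)
  · linear_combination Y 1 0 * a3 - X 1 0 * b3
  · linear_combination -(Y 1 0 * a1 - X 1 0 * b1)
  · linear_combination (Y 0 0 - Y 1 1) * a1 - X 1 0 * b2 + X 0 1 * b3
  · linear_combination -((Y 0 0 - Y 1 1) * a2 - (X 0 0 - X 1 1) * b2)
  · linear_combination (Y 0 0 - Y 1 1) * a3 - (X 0 0 - X 1 1) * b3
  · linear_combination -((Y 0 0 - Y 1 1) * a1 - X 1 0 * b2 + X 0 1 * b3)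

/-- Products of entries of multiples vanish when products of entries of the factors do. -/
theorem mul_apply_mul_mul_apply {M N : Matrix (Fin 2) (Fin 2) A}
    (h : ∀ i j k l, M i j * N k l = 0) (P Q : Matrix (Fin 2) (Fin 2) A) (i j k l : Fin 2) :
    (P * M) i j * (Q * N) k l = 0 := by
  simp only [mul_apply, Fin.sum_univ_two]
  linear_combination P i 0 * Q k 0 * h 0 j 0 l + P i 0 * Q k 1 * h 0 j 1 l +
    P i 1 * Q k 0 * h 1 j 0 l + P i 1 * Q k 1 * h 1 j 1 l

/-- If the same unimodular matrix is a multiplicative commutator in two ways, and the first pair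
centralizes an element of the second, then it has trace two. -/
theorem trace_eq_two_of_commutators {X Y W V Z : Matrix (Fin 2) (Fin 2) A}
    (hX : IsUnit X) (hY : IsUnit Y) (hW : IsUnit W) (hV : IsUnit V)
    (hXW : X * W = W * X) (hYW : Y * W = W * Y)
    (hXY : X * Y = Y * X * Z) (hWV : W * V = V * W * Z) : Z.trace = 2 := by
  obtain ⟨P, hP⟩ := (hY.mul hX).exists_left_inv
  obtain ⟨Q, hQ⟩ := (hV.mul hW).exists_left_inv
  have h := mul_apply_mul_mul_apply
    (commutator_apply_mul_commutator_apply (W := V) hXW hYW) P Q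
  have h1 : P * (X * Y - Y * X) = Z - 1 := by
    rw [hXY, mul_sub, ← mul_assoc, hP, one_mul]
  have h2 : Q * (W * V - V * W) = Z - 1 := by
    rw [hWV, mul_sub, ← mul_assoc, hQ, one_mul]
  rw [h1, h2] at h
  have hdet : Z.det = 1 := by
    have hd := congrArg det hXY
    rw [det_mul, det_mul, det_mul, mul_comm X.det] at hd
    have hu : IsUnit (Y.det * X.det) :=
      ((isUnit_iff_isUnit_det _).1 hY).mul ((isUnit_iff_isUnit_det _).1 hX)
    exact (hu.mul_left_cancel ((mul_one _).trans hd)).symm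
  have h3 := h 0 0 1 1
  have h4 := h 0 1 1 0
  rw [det_fin_two] at hdet
  rw [trace_fin_two]
  simp at h3 h4
  linear_combination hdet - h3 + h4

end Matrix

namespace ExtraspecialGroup

/-- The element `a ^ 2` has trace two in every two-dimensional representation. -/
theorem trace_extraA_sq {A : Type*} [CommRing A] (ρ : ExtraspecialGroup →* GL (Fin 2) A) :
    (ρ (extraA ^ 2) : Matrix (Fin 2) (Fin 2) A).trace = 2 := by
  let f (t : ExtraGen) : ExtraspecialGroup := PresentedGroup.of t
  have hf (r) (hr : r ∈ extraRels) : FreeGroup.lift f r = 1 := by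
    rw [lift_of]
    exact PresentedGroup.one_of_mem hr
  have h1 := hf _ (.inl rfl)
  have h2 := hf _ (.inr (.inl rfl))
  have h3 := hf _ (.inr (.inr (.inl rfl)))
  have h5 := hf _ (.inr (.inr (.inr (.inr (.inl rfl)))))
  have h6 := hf _ (.inr (.inr (.inr (.inr (.inr (.inl rfl))))))
  have h8 := hf _ (.inr (.inr (.inr (.inr (.inr (.inr (.inr (.inl rfl))))))))
  have h10 := hf _ (.inr (.inr (.inr (.inr (.inr (.inr (.inr (.inr (.inr rfl)))))))))
  simp only [map_mul, map_pow, map_inv, FreeGroup.lift_apply_of, mul_inv_eq_one, inv_inv]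
    at h1 h2 h3 h5 h6 h8 h10
  change (ρ (f .a ^ 2) : Matrix (Fin 2) (Fin 2) A).trace = 2
  have hab : f .a * f .b = f .b * f .a * f .a ^ 2 := by
    have h : f .a ^ 3 * f .a = 1 := by rw [← pow_succ, h1]
    rw [mul_assoc, ← pow_succ', ← mul_right_inj (f .b), ← mul_assoc, ← mul_assoc, ← pow_two, h2,
      one_mul, eq_inv_of_mul_eq_one_left h5, eq_inv_of_mul_eq_one_left h]
  have hcd : f .c * f .d = f .d * f .c * f .a ^ 2 := by
    rw [← mul_right_inj (f .d), ← mul_assoc, h10, ← mul_assoc, ← mul_assoc, ← pow_two, h3, one_mul]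
    exact (Commute.pow_left h6 2).eq
  have hu (g : ExtraspecialGroup) : IsUnit (ρ g : Matrix (Fin 2) (Fin 2) A) := (ρ g).isUnit
  have hm {g g' : ExtraspecialGroup} (h : g = g') :
      (ρ g : Matrix (Fin 2) (Fin 2) A) = ρ g' := by rw [h]
  have h6' := hm h6
  have h8' := hm h8
  have hab' := hm hab
  have hcd' := hm hcd
  simp only [map_mul, Units.val_mul] at h6' h8' hab' hcd'
  exact Matrix.trace_eq_two_of_commutators (hu _) (hu _) (hu _) (hu _) h6' h8' hab' hcd'

end ExtraspecialGroup

end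

/-! ### The coefficient subring and the comparison of the two rings. -/

noncomputable section

/-- A surjective endomorphism of a Noetherian ring is injective. -/
theorem RingHom.injective_of_surjective_endomorphism {R : Type*} [CommRing R] [IsNoetherianRing R]
    (f : R →+* R) (hf : Function.Surjective f) : Function.Injective f := by
  have hmono : Monotone fun n => RingHom.ker (f ^ n) := by
    refine monotone_nat_of_le_succ fun n x hx => ?_
    rw [RingHom.mem_ker] at hx ⊢
    rw [pow_succ', RingHom.mul_def, RingHom.comp_apply, hx, map_zero]
  obtain ⟨n, hn⟩ := monotone_stabilizes_iff_noetherian.mpr ‹IsNoetherianRing R› ⟨_, hmono⟩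
  refine (injective_iff_map_eq_zero f).2 fun x hx => ?_
  have hs : Function.Surjective (f ^ n) := by
    rw [RingHom.coe_pow]
    exact hf.iterate n
  obtain ⟨y, rfl⟩ := hs x
  have hy : y ∈ RingHom.ker (f ^ (n + 1)) := by
    rw [RingHom.mem_ker, pow_succ', RingHom.mul_def, RingHom.comp_apply, hx]
  have h := hn (n + 1) n.le_succ
  change RingHom.ker (f ^ n) = RingHom.ker (f ^ (n + 1)) at h
  rwa [← h] at hy

namespace TraceDet

/-- Pullback along a homomorphism of groups. -/
def comap {A : Type*} [CommRing A] {G H : Type*} [Group G] [Group H] (P : TraceDet A H)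
    (f : G →* H) : TraceDet A G where
  tr g := P.tr (f g)
  det := P.det.comp f
  tr_one := by rw [map_one, P.tr_one]
  tr_mul_comm g h := by rw [map_mul, map_mul, P.tr_mul_comm]
  tr_mul_tr g h := by simp [P.tr_mul_tr]

end TraceDet

section CoeffSubring

variable {p : ℕ} [Fact p.Prime] {G : Type w} [Group G] [Finite G] {S : CoeffRing p} (ρ : G →* GL (Fin 2) S)

theorem coeffSubring_eq_adjoin :
    coeffSubring ρ = Algebra.adjoin ℤ_[p] (Set.range (GroupDet.ofRep ρ).toTraceDet.tr ∪
      Set.range (GroupDet.ofRep ρ).toTraceDet.det) := by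
  refine le_antisymm (Algebra.adjoin_le ?_) (Algebra.adjoin_le ?_)
  · rintro r ⟨g, i, rfl⟩
    have htr := Algebra.subset_adjoin (R := ℤ_[p]) (Set.mem_union_left
      (Set.range (GroupDet.ofRep ρ).toTraceDet.det)
      (Set.mem_range_self (f := (GroupDet.ofRep ρ).toTraceDet.tr) g))
    have hdet := Algebra.subset_adjoin (R := ℤ_[p]) (Set.mem_union_right
      (Set.range (GroupDet.ofRep ρ).toTraceDet.tr)
      (Set.mem_range_self (f := (GroupDet.ofRep ρ).toTraceDet.det) g))
    rw [GroupDet.toTraceDet_ofRep_tr] at htr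
    rw [GroupDet.toTraceDet_ofRep_det] at hdet
    rw [Matrix.charpoly_fin_two]
    simp only [Polynomial.coeff_add, Polynomial.coeff_sub, Polynomial.coeff_X_pow,
      Polynomial.coeff_C_mul, Polynomial.coeff_X, Polynomial.coeff_C]
    refine add_mem (sub_mem ?_ (mul_mem htr ?_)) ?_
    · split_ifs <;> simp
    · split_ifs <;> simp
    · split_ifs
      · exact hdet
      · exact zero_mem _
  · rintro r (⟨g, rfl⟩ | ⟨g, rfl⟩)
    · have h := Algebra.subset_adjoin (R := ℤ_[p]) (s := {r | ∃ (g : G) (i : ℕ),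
        r = (ρ g : Matrix (Fin 2) (Fin 2) S).charpoly.coeff i}) ⟨g, 1, rfl⟩
      rw [Matrix.charpoly_fin_two] at h
      rw [GroupDet.toTraceDet_ofRep_tr, coeffSubring]
      simpa [Polynomial.coeff_X, Polynomial.coeff_C] using neg_mem h
    · have h := Algebra.subset_adjoin (R := ℤ_[p]) (s := {r | ∃ (g : G) (i : ℕ),
        r = (ρ g : Matrix (Fin 2) (Fin 2) S).charpoly.coeff i}) ⟨g, 0, rfl⟩
      rw [Matrix.charpoly_fin_two] at h
      rw [GroupDet.toTraceDet_ofRep_det, coeffSubring]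
      simpa [Polynomial.coeff_X] using h

theorem range_lift_toTraceDet_ofRep :
    (TraceDet.lift (GroupDet.ofRep ρ).toTraceDet :
      TraceDet.UniversalRing ℤ_[p] G →ₐ[ℤ_[p]] S).range = coeffSubring ρ := by
  have h := TraceDet.map_lift_univ (k := ℤ_[p]) (GroupDet.ofRep ρ).toTraceDet
  rw [coeffSubring_eq_adjoin, ← Algebra.map_top, ← TraceDet.adjoin_univ, AlgHom.map_adjoin,
    Set.image_union, ← Set.range_comp, ← Set.range_comp]
  congr 3
  · exact congrArg TraceDet.tr h
  · exact funext fun g => congrArg (fun P => P.det g) h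

end CoeffSubring

/-- For a finite 2-group, the universal pseudodeformation ring surjects onto the coefficient
subring of every lifting. -/
theorem IsUniversalPseudodeformation.exists_surjective_coeffSubring {G : Type} [Group G] [Finite G]
    (hG : IsPGroup 2 G) {Dbar : GroupDet (ZMod 2) G 2} {R : CoeffRing 2} {D : GroupDet R G 2}
    (hR : IsUniversalPseudodeformation Dbar R D) {S : CoeffRing 2} (ρ : G →* GL (Fin 2) S) :
    ∃ π : R →ₐ[ℤ_[2]] coeffSubring ρ,
      D.SpecializesTo (((coeffSubring ρ).val.comp π : R →ₐ[ℤ_[2]] S) : R →+* S)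
        (GroupDet.ofRep ρ) ∧
      (∀ π' : R →ₐ[ℤ_[2]] coeffSubring ρ,
        D.SpecializesTo (((coeffSubring ρ).val.comp π' : R →ₐ[ℤ_[2]] S) : R →+* S)
          (GroupDet.ofRep ρ) → π' = π) ∧
      Function.Surjective π := by
  obtain ⟨e, he⟩ := hR.exists_algEquiv hG
  let g : TraceDet.UniversalRing ℤ_[2] G →ₐ[ℤ_[2]] S :=
    TraceDet.lift (GroupDet.ofRep ρ).toTraceDet
  have hg : (TraceDet.univ ℤ_[2] G).map (g : TraceDet.UniversalRing ℤ_[2] G →+* S) =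
    (GroupDet.ofRep ρ).toTraceDet := TraceDet.map_lift_univ _
  have hrange : g.range = coeffSubring ρ := range_lift_toTraceDet_ofRep ρ
  have hmem (x : R) : g (e.symm x) ∈ coeffSubring ρ := by
    rw [← hrange]
    exact ⟨_, rfl⟩
  -- Traces and determinants generate both the ring of pairs and the coefficient subring, so the
  -- classifying map has exactly this range.
  let π : R →ₐ[ℤ_[2]] coeffSubring ρ :=
    (g.comp (e.symm : R →ₐ[ℤ_[2]] TraceDet.UniversalRing ℤ_[2] G)).codRestrict _ hmem
  have hπ : ((coeffSubring ρ).val.comp π).comp (e : _ →ₐ[ℤ_[2]] R) = g := by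
    ext x
    change g (e.symm (e x)) = g x
    rw [e.symm_apply_apply]
  refine ⟨π, ?_, fun π' hπ' => ?_, ?_⟩
  · rw [GroupDet.specializesTo_iff, ← he, TraceDet.map_map, ← hg, ← hπ]
    rfl
  · rw [GroupDet.specializesTo_iff, ← he, TraceDet.map_map, ← hg] at hπ'
    have h : ((coeffSubring ρ).val.comp π').comp (e : _ →ₐ[ℤ_[2]] R) = g :=
      TraceDet.algHom_ext hπ'.symm
    ext x
    obtain ⟨y, rfl⟩ := e.surjective x
    exact (DFunLike.congr_fun h y).trans (DFunLike.congr_fun hπ y).symm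
  · rintro ⟨s, hs⟩
    rw [← hrange] at hs
    obtain ⟨x, hx⟩ := hs
    refine ⟨e x, Subtype.ext ?_⟩
    exact (DFunLike.congr_fun hπ x).trans hx

namespace ExtraspecialGroup

theorem toCentralExt_extraA_sq : toCentralExt (extraA ^ 2) = ⟨1, 0⟩ := by
  have h2 : (1 : ZMod 2) + 1 = 0 := by decide
  rw [map_pow, pow_two, extraA, toCentralExt_of, genImage]
  ext i
  · simp [cocycle_apply]
  · fin_cases i <;> simp [h2]

/-- The universal determinant separates `a ^ 2` from the identity by its trace. -/
theorem trace_extraA_sq_ne_two {Dbar : GroupDet (ZMod 2) ExtraspecialGroup 2} {R : CoeffRing 2}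
    {D : GroupDet R ExtraspecialGroup 2} (hR : IsUniversalPseudodeformation Dbar R D) :
    D.trace (extraA ^ 2) ≠ 2 := by
  intro h
  let V := Fin 4 → ZMod 2
  have hV (v : V) : v + v = 0 := funext fun i => CharTwo.add_self_eq_zero (v i)
  let A : CoeffRing 2 := QuadricAlgebra.coeffRing V
  let P : TraceDet A ExtraspecialGroup := (CentralExt.traceDet cocycle hV).comap toCentralExt
  -- Over `𝔽₂` there is only one pair, so `P` has the required reduction.
  have : Subsingleton (TraceDet (ZMod 2) ExtraspecialGroup) :=
    TraceDet.subsingleton_of_isDomain rfl isPGroup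
  have hA : IsArtinianRing A := inferInstanceAs (IsArtinianRing (QuadricAlgebra V))
  obtain ⟨f, hf, -⟩ := hR.existsUnique_algHom A hA P (Subsingleton.elim _ _)
  have h1 : f (D.trace (extraA ^ 2)) = P.tr (extraA ^ 2) :=
    congrArg (fun Q => Q.tr (extraA ^ 2)) hf
  rw [h, map_ofNat] at h1
  have h2 : (2 : QuadricAlgebra V) =
      (CentralExt.traceDet cocycle hV).tr (toCentralExt (extraA ^ 2)) := h1
  rw [toCentralExt_extraA_sq, QuadricAlgebra.two_eq_zero] at h2
  have h3 := congrArg QuadricAlgebra.deg2 h2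
  exact absurd h3 (by simp [CentralExt.traceDet])

/-- Determinants that specialize to representations have trace two at `a ^ 2`. -/
theorem map_trace_extraA_sq {A : Type u} {B : Type v} [CommRing A] [CommRing B]
    {D : GroupDet A ExtraspecialGroup 2} {f : A →+* B} {σ : ExtraspecialGroup →* GL (Fin 2) B}
    (h : D.SpecializesTo f (GroupDet.ofRep σ)) : f (D.trace (extraA ^ 2)) = 2 := by
  rw [GroupDet.specializesTo_iff] at h
  have h1 := congrArg (fun P => P.tr (extraA ^ 2)) h
  rw [← trace_extraA_sq σ, ← GroupDet.toTraceDet_ofRep_tr]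
  exact h1.symm

end ExtraspecialGroup

end

/-- For the extraspecial group `2_+^{1+4}` and the trivial two-dimensional residual representation
over `𝔽_2`, the natural surjection from the universal pseudodeformation ring onto the coefficient
subring of the universal framed deformation ring is not an isomorphism. -/
theorem theorem3p1 :
    -- the group is finite of order 32, and both deformation rings exist
    Nat.card ExtraspecialGroup = 32 ∧
    (∃ (R : CoeffRing 2) (D : GroupDet R ExtraspecialGroup 2),
      IsUniversalPseudodeformation
        (GroupDet.ofRep (1 : ExtraspecialGroup →* GL (Fin 2) (ZMod 2))) R D) ∧
    (∃ (S : CoeffRing 2) (ρ : ExtraspecialGroup →* GL (Fin 2) S),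
      IsUniversalLifting (1 : ExtraspecialGroup →* GL (Fin 2) (ZMod 2)) S ρ) ∧
    ∀ (R : CoeffRing 2) (D : GroupDet R ExtraspecialGroup 2)
      (S : CoeffRing 2) (ρ : ExtraspecialGroup →* GL (Fin 2) S),
      IsUniversalPseudodeformation
        (GroupDet.ofRep (1 : ExtraspecialGroup →* GL (Fin 2) (ZMod 2))) R D →
      IsUniversalLifting (1 : ExtraspecialGroup →* GL (Fin 2) (ZMod 2)) S ρ →
      -- the natural map from `R` to the coefficient subring is a surjection, not an isomorphism
      (∃ π : R →ₐ[ℤ_[2]] coeffSubring ρ,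
        D.SpecializesTo (((coeffSubring ρ).val.comp π : R →ₐ[ℤ_[2]] S) : R →+* S)
          (GroupDet.ofRep ρ) ∧
        (∀ π' : R →ₐ[ℤ_[2]] coeffSubring ρ,
          D.SpecializesTo (((coeffSubring ρ).val.comp π' : R →ₐ[ℤ_[2]] S) : R →+* S)
            (GroupDet.ofRep ρ) → π' = π) ∧
        Function.Surjective π ∧ ¬ Function.Injective π) ∧
      -- the two rings are not isomorphic at all
      IsEmpty (R ≃+* coeffSubring ρ) ∧
      -- the element that is killed
      D.trace (extraA ^ 2) - 2 ≠ 0 ∧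
      (ρ (extraA ^ 2) : Matrix (Fin 2) (Fin 2) S).trace - 2 = 0 ∧
      -- the universal determinant does not come from a representation over any extension of `R`
      (∀ (B : Type*) [CommRing B] (f : R →+* B), Function.Injective f →
        ∀ σ : ExtraspecialGroup →* GL (Fin 2) B, ¬ D.SpecializesTo f (GroupDet.ofRep σ)) := by

  have hG := ExtraspecialGroup.isPGroup
  refine ⟨ExtraspecialGroup.card, ⟨_, _,
    TraceDet.isUniversalPseudodeformation_toGroupDet _ hG⟩, exists_isUniversalLifting _, ?_⟩
  intro R D S ρ hR _
  have hne := ExtraspecialGroup.trace_extraA_sq_ne_two hR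
  have hρ := ExtraspecialGroup.trace_extraA_sq ρ
  obtain ⟨π, hπ, huniq, hsurj⟩ := hR.exists_surjective_coeffSubring hG ρ
  -- Both `T(a²)` and `2` are sent to `2`, since the image of `T(a²)` is the trace of a matrix
  -- `ρ(a²)`.
  have hinj : ¬ Function.Injective π := fun hinj => hne (hinj (Subtype.ext (by
    rw [map_ofNat]
    exact ExtraspecialGroup.map_trace_extraA_sq hπ)))
  refine ⟨⟨π, hπ, huniq, hsurj, hinj⟩, ⟨fun e => hinj ?_⟩, sub_ne_zero.mpr hne,
    sub_eq_zero.mpr hρ, fun B _ f hf σ h => hne (hf ?_)⟩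
  · have : IsNoetherianRing R := hR.complete.1
    -- Composed with `π`, the inverse of an isomorphism is a surjective endomorphism of `R`, hence
    -- injective, which would make `π` injective.
    have h := RingHom.injective_of_surjective_endomorphism
      ((e.symm : coeffSubring ρ →+* R).comp (π : R →+* coeffSubring ρ))
      (e.symm.surjective.comp hsurj)
    exact Function.Injective.of_comp h
  · rw [ExtraspecialGroup.map_trace_extraA_sq h, map_ofNat]
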